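/- Let $\mathbb X$ be a finite-dimensional real inner product space and let $f=\vartheta\circ F$ with $\vartheta:\mathbb R^m\to\mathbb R\cup\{\infty\}$ and $F:\mathbb X\to\mathbb R^m$. Assume that $\vartheta$ is piecewise twice differentiable (PWTD): ${\rm dom}\,\vartheta$ is nonempty and is a finite union of polyhedral sets $C_1,\dots,C_s$, and on each $C_i$ the function $\vartheta$ coincides with a real function that is twice differentiable on an open superset of $C_i$. Assume also that $\vartheta$ is locally Lipschitz continuous relative to ${\rm dom}\,\vartheta$, and that $F$ is twice differentiable on an open set $\mathcal O\supset F^{-1}({\rm dom}\,\vartheta)$. Let $\bar x\in{\rm dom}\,f$ and $\bar v\in\partial f(\bar x)$, where $\partial$ is the basic (limiting) subdifferential. Suppose that 1. the metric subregularity qualification condition (MSQC) holds for the system $F(x)\in{\rm dom}\,\vartheta$ at $\bar x$, i.e. there are $\kappa>0$, $\varepsilon>0$ with ${\rm dist}(x,{\rm dom}\,f)\le\kappa\,{\rm dist}(F(x),{\rm dom}\,\vartheta)$ whenever $\|x-\bar x\|\le\varepsilon$; 2. $\partial f(\bar x)\subset\nabla F(\bar x)\,\partial\vartheta(F(\bar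 x))$, where $\nabla F(\bar x)$ is the adjoint of the derivative $F'(\bar x)$; 3. $\vartheta$ is regular at $F(\bar x)$, i.e. the regular and the limiting normal cone to ${\rm epi}\,\vartheta$ at $(F(\bar x),\vartheta(F(\bar x)))$ coincide. For a function $h$ finite at $x$ write $$dh(x)(w)=\liminf_{\tau\downarrow0,\,w'\to w}\frac{h(x+\tau w')-h(x)}{\tau},\qquad d^2h(x)(w)=\liminf_{\tau\downarrow0,\,w'\to w}\frac{h(x+\tau w')-h(x)-\tau\,dh(x)(w')}{\tau^2/2},$$ $$\Delta^2_\tau h(x|v)(w')=\frac{h(x+\tau w')-h(x)-\tau\langle v,w'\rangle}{\tau^2/2},\qquad d^2h(x|v)(w)=\liminf_{\tau\downarrow0,\,w'\to w}\Delta^2_\tau h(x|v)(w'),$$ and, for $dh(x)(w)$ finite, $$d^2h(x)(w|z)=\liminf_{\tau\downarrow0,\,z'\to z}\frac{h(x+\tau w+\frac12\tau^2z')-h(x)-\tau\,dh(x)(w)}{\tau^2/2},$$ where the quotient defining $d^2h(x)(w)$ is read as $\infty$ when $h(x+\tau w')=dh(x)(w')=\pm\infty$. Let $\mathcal C_f(\bar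 x,\bar v)=\{w: df(\bar x)(w)=\langle\bar v,w\rangle\}$. Let $$dF(\bar x)(w)=\lim_{\tau\downarrow0,\,w'\to w}\frac{F(\bar x+\tau w')-F(\bar x)}{\tau},\qquad F''(\bar x;w,z)=\lim_{\tau\downarrow0,\,z'\to z}\frac{F(\bar x+\tau w+\frac12\tau^2z')-F(\bar x)-\tau\,dF(\bar x)(w)}{\tau^2/2}$$ be the semiderivative and the parabolic semiderivative, let $(\xi F)(x)=\langle\xi,F(x)\rangle$, and put $$\Lambda_{\bar x,\bar v}=\{\xi\in\partial\vartheta(F(\bar x)):\ \langle\xi,dF(\bar x)(w')\rangle\ge\langle\bar v,w'\rangle\ \ \forall w'\in\mathbb X\},$$ $$\mathcal A_\vartheta(y,u)=\{\eta\in\partial\vartheta(y):\ d\vartheta(y)(u)=\langle\eta,u\rangle\}.$$ Then the limits $dF(\bar x)(w)$ and $F''(\bar x;w,z)$ exist for all $w,z\in\mathbb X$, and for every $w\in\mathcal C_f(\bar x,\bar v)$ there is $\bar\xi\in\Lambda_{\bar x,\bar v}$ such that $$\inf_{z\in\mathbb X}\Big\{\sup_{u\in\mathcal A_\vartheta(F(\bar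 x),dF(\bar x)(w))}\langle u,F''(\bar x;w,z)\rangle-\langle\bar v,z\rangle\Big\}=d^2(\bar\xi F)(\bar x)(w).$$ Consequently, $f$ is parabolically regular at $\bar x$ for $\bar v$, i.e. $\inf_{z\in\mathbb X}\{d^2f(\bar x)(w|z)-\langle\bar v,z\rangle\}=d^2f(\bar x|\bar v)(w)$ for every $w\in\mathcal C_f(\bar x,\bar v)$; and $f$ is properly twice epi-differentiable at $\bar x$ for $\bar v$, i.e. the functions $\Delta^2_\tau f(\bar x|\bar v)$ epi-converge to $d^2f(\bar x|\bar v)$ as $\tau\downarrow0$ and $d^2f(\bar x|\bar v)$ is proper. -/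

import Mathlib

open Filter Topology

namespace CompositeVA

section General

variable {E : Type*} [NormedAddCommGroup E] [InnerProductSpace ℝ E]

/-- The (effective) domain of an extended-real-valued function. -/
def dom {α : Type*} (h : α → EReal) : Set α := {x | h x < ⊤}

/-- A proper function: never `-∞` and not identically `∞`. -/
def IsProper {α : Type*} (h : α → EReal) : Prop := (∀ x, h x ≠ ⊥) ∧ (dom h).Nonempty

/-- The epigraph of an extended-real-valued function. -/
def epi {α : Type*} (h : α → EReal) : Set (α × ℝ) := {p | h p.1 ≤ (p.2 : EReal)}

open Classical in
/-- The indicator function of a set, `0` on the set and `∞` outside. -/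
noncomputable def indicatorFn {α : Type*} (S : Set α) (x : α) : EReal := if x ∈ S then 0 else ⊤

/-! ### Subdifferentials, normal cones, regularity -/

/-- The regular (Fréchet) subdifferential at a point where the function is finite
(empty at all other points). -/
noncomputable def regSubdiff (h : E → EReal) (x : E) : Set E :=
  {v | h x ≠ ⊥ ∧ h x ≠ ⊤ ∧
    0 ≤ liminf (fun x' : E =>
      (h x' - h x - ((inner ℝ v (x' - x) : ℝ) : EReal)) / ((‖x' - x‖ : ℝ) : EReal)) (𝓝[≠] x)}

/-- The basic (limiting, Mordukhovich) subdifferential at a point where the function is finite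
(empty at all other points). -/
noncomputable def subdiff (h : E → EReal) (x : E) : Set E :=
  {v | h x ≠ ⊥ ∧ h x ≠ ⊤ ∧
    ∃ (xs vs : ℕ → E), Tendsto xs atTop (𝓝 x) ∧ Tendsto (fun k => h (xs k)) atTop (𝓝 (h x)) ∧
      (∀ k, vs k ∈ regSubdiff h (xs k)) ∧ Tendsto vs atTop (𝓝 v)}

/-- The regular normal cone, as the regular subdifferential of the indicator. -/
noncomputable def regNormalCone (S : Set E) (x : E) : Set E := regSubdiff (indicatorFn S) x

/-- The (limiting) normal cone, as the subdifferential of the indicator. -/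
noncomputable def normalCone (S : Set E) (x : E) : Set E := subdiff (indicatorFn S) x

/-- Clarke regularity of a set at a point. -/
def ClarkeRegularAt (S : Set E) (x : E) : Prop := regNormalCone S x = normalCone S x

/-- The function `h` is regular at `x`: its epigraph is Clarke regular at `(x, h x)`.
The product `E × ℝ` carries the inner product `⟨a, b⟩ + s * t`, hence `WithLp 2`. -/
def RegularAt (h : E → EReal) (x : E) : Prop :=
  ClarkeRegularAt {p : WithLp 2 (E × ℝ) | WithLp.ofLp p ∈ epi h} (WithLp.toLp 2 (x, (h x).toReal))

/-! ### Set convergence and epi-convergence -/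

/-- The outer limit of a family of sets along a filter. -/
def outerLim {ι α : Type*} [TopologicalSpace α] (l : Filter ι) (S : ι → Set α) : Set α :=
  {x | ∀ U ∈ 𝓝 x, ∃ᶠ i in l, (S i ∩ U).Nonempty}

/-- The inner limit of a family of sets along a filter. -/
def innerLim {ι α : Type*} [TopologicalSpace α] (l : Filter ι) (S : ι → Set α) : Set α :=
  {x | ∀ U ∈ 𝓝 x, ∀ᶠ i in l, (S i ∩ U).Nonempty}

/-- Epi-convergence: the lower and the upper epi-limit (the functions whose epigraphs are the outer
and the inner limit of the epigraphs) both equal `g`. -/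
def EpiTendsto {ι α : Type*} [TopologicalSpace α] (l : Filter ι) (φ : ι → α → EReal)
    (g : α → EReal) : Prop :=
  outerLim l (fun i => epi (φ i)) = epi g ∧ innerLim l (fun i => epi (φ i)) = epi g

/-! ### First and second subderivatives, parabolic subderivatives -/

/-- The subderivative `dh(x)(w)`. -/
noncomputable def subderiv (h : E → EReal) (x w : E) : EReal :=
  liminf (fun p : ℝ × E => (h (x + p.1 • p.2) - h x) / (p.1 : EReal)) (𝓝[>] (0 : ℝ) ×ˢ 𝓝 w)

/-- The critical cone of `h` at `x` for `v`. -/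
def criticalCone (h : E → EReal) (x v : E) : Set E :=
  {w | subderiv h x w = ((inner ℝ v w : ℝ) : EReal)}

open Classical in
/-- The second-order difference quotient without mention of `v`, equal to `∞` whenever
`h (x + τ w') = dh(x)(w') = ±∞`. -/
noncomputable def quot2 (h : E → EReal) (x : E) (τ : ℝ) (w' : E) : EReal :=
  if h (x + τ • w') = subderiv h x w' ∧ (subderiv h x w' = ⊤ ∨ subderiv h x w' = ⊥) then ⊤
  else (h (x + τ • w') - h x - (τ : EReal) * subderiv h x w') / ((τ ^ 2 / 2 : ℝ) : EReal)

/-- The second subderivative `d²h(x)(w)` (without mention of `v`). -/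
noncomputable def subderiv2 (h : E → EReal) (x w : E) : EReal :=
  liminf (fun p : ℝ × E => quot2 h x p.1 p.2) (𝓝[>] (0 : ℝ) ×ˢ 𝓝 w)

/-- The second-order difference quotient `Δ²_τ h(x|v)(w')`. -/
noncomputable def quot2For (h : E → EReal) (x v : E) (τ : ℝ) (w' : E) : EReal :=
  (h (x + τ • w') - h x - ((τ * inner ℝ v w' : ℝ) : EReal)) / ((τ ^ 2 / 2 : ℝ) : EReal)

/-- The second subderivative `d²h(x|v)(w)`. -/
noncomputable def subderiv2For (h : E → EReal) (x v w : E) : EReal :=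
  liminf (fun p : ℝ × E => quot2For h x v p.1 p.2) (𝓝[>] (0 : ℝ) ×ˢ 𝓝 w)

/-- Proper twice epi-differentiability of `h` at `x` for `v`: the quotients `Δ²_τ h(x|v)`
epi-converge, as `τ ↓ 0`, to `d²h(x|v)`, and this function is proper. -/
def ProperlyTwiceEpiDifferentiableAt (h : E → EReal) (x v : E) : Prop :=
  EpiTendsto (𝓝[>] (0 : ℝ)) (fun τ => quot2For h x v τ) (subderiv2For h x v) ∧
    IsProper (subderiv2For h x v)

/-- The parabolic subderivative `d²h(x)(w|z)`, meant for `w` with `dh(x)(w)` finite. -/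
noncomputable def parSubderiv (h : E → EReal) (x w z : E) : EReal :=
  liminf (fun p : ℝ × E =>
    (h (x + p.1 • w + (p.1 ^ 2 / 2) • p.2) - h x - (p.1 : EReal) * subderiv h x w) /
      ((p.1 ^ 2 / 2 : ℝ) : EReal)) (𝓝[>] (0 : ℝ) ×ˢ 𝓝 z)

/-- Parabolic regularity of `h` at `x` for `v`. -/
def ParabolicallyRegularAt (h : E → EReal) (x v : E) : Prop :=
  ∀ w ∈ criticalCone h x v,
    (⨅ z : E, (parSubderiv h x w z - ((inner ℝ v z : ℝ) : EReal))) = subderiv2For h x v w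

/-! ### Piecewise twice differentiable functions -/

/-- A polyhedral set: a finite intersection of closed half-spaces. -/
def IsPolyhedral (C : Set E) : Prop :=
  ∃ (k : ℕ) (a : Fin k → E) (b : Fin k → ℝ), C = {x | ∀ i, inner ℝ (a i) x ≤ b i}

/-- Twice differentiability on a set, used for open sets only. -/
def TwiceDifferentiableOn {G : Type*} [NormedAddCommGroup G] [NormedSpace ℝ G]
    (g : E → G) (U : Set E) : Prop :=
  DifferentiableOn ℝ g U ∧ DifferentiableOn ℝ (fderiv ℝ g) U

/-- Piecewise twice differentiable (PWTD) functions. -/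
def IsPWTD (h : E → EReal) : Prop :=
  (dom h).Nonempty ∧ ∃ (s : ℕ) (C : Fin s → Set E), (∀ i, IsPolyhedral (C i)) ∧
    dom h = ⋃ i, C i ∧
    ∀ i, ∃ (g : E → ℝ) (U : Set E), IsOpen U ∧ C i ⊆ U ∧ TwiceDifferentiableOn g U ∧
      ∀ x ∈ C i, h x = (g x : EReal)

/-- Strict continuity (local Lipschitz continuity) relative to the domain, for functions
that are real-valued on their domain. -/
def StrictlyContinuousOnDom (h : E → EReal) : Prop :=
  LocallyLipschitzOn (dom h) (fun x => (h x).toReal)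

end General

section Maps

variable {X Y : Type*} [NormedAddCommGroup X] [InnerProductSpace ℝ X]
  [NormedAddCommGroup Y] [InnerProductSpace ℝ Y]

/-! ### Metric subregularity -/

/-- Metric subregularity of a multifunction at `(x, y)`. Distances are extended, so that the
distance to the empty set is `∞`. -/
def MetricallySubregularAt (M : X → Set Y) (x : X) (y : Y) : Prop :=
  y ∈ M x ∧ ∃ κ : ℝ, 0 < κ ∧ ∃ ε : ℝ, 0 < ε ∧ ∀ x' ∈ Metric.closedBall x ε,
    Metric.infEDist x' {u | y ∈ M u} ≤ ENNReal.ofReal κ * Metric.infEDist y (M x')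

/-- The metric subregularity qualification condition for the system `F(x) ∈ dom ϑ`:
`x ↦ F(x) - dom ϑ` is metrically subregular at `(x, 0)`. -/
def MSQC (ϑ : Y → EReal) (F : X → Y) (x : X) : Prop :=
  MetricallySubregularAt (fun u => (fun y => F u - y) '' dom ϑ) x 0

/-! ### Semiderivatives and parabolic semiderivatives of mappings -/

/-- `d` is the semiderivative of `g` at `x` for `w`. -/
def HasSemideriv (g : X → Y) (x w : X) (d : Y) : Prop :=
  Tendsto (fun p : ℝ × X => p.1⁻¹ • (g (x + p.1 • p.2) - g x)) (𝓝[>] (0 : ℝ) ×ˢ 𝓝 w) (𝓝 d)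

/-- The semiderivative `dg(x)(w)`. -/
noncomputable def semideriv (g : X → Y) (x w : X) : Y :=
  limUnder (𝓝[>] (0 : ℝ) ×ˢ 𝓝 w) (fun p : ℝ × X => p.1⁻¹ • (g (x + p.1 • p.2) - g x))

/-- The parabolic difference quotient of the mapping `g`. -/
noncomputable def parQuot (g : X → Y) (x w : X) (p : ℝ × X) : Y :=
  (p.1 ^ 2 / 2)⁻¹ • (g (x + p.1 • w + (p.1 ^ 2 / 2) • p.2) - g x - p.1 • semideriv g x w)

/-- The parabolic semiderivative `g''(x; w, z)`. -/
noncomputable def parSemideriv (g : X → Y) (x w z : X) : Y :=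
  limUnder (𝓝[>] (0 : ℝ) ×ˢ 𝓝 z) (parQuot g x w)

/-- Parabolic semidifferentiability of `g` at `x`. -/
def ParabolicallySemidifferentiableAt (g : X → Y) (x : X) : Prop :=
  ∀ w, (∃ d, HasSemideriv g x w d) ∧
    ∀ z, ∃ d, Tendsto (parQuot g x w) (𝓝[>] (0 : ℝ) ×ˢ 𝓝 z) (𝓝 d)

/-! ### The sufficient condition for parabolic regularity -/

/-- `𝒜_ϑ(y, w)`: the subgradients `u` of `ϑ` at `y` with `dϑ(y)(w) = ⟨u, w⟩`. -/
def activeSubgrads (ϑ : Y → EReal) (y w : Y) : Set Y :=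
  {u | u ∈ subdiff ϑ y ∧ subderiv ϑ y w = ((inner ℝ u w : ℝ) : EReal)}

/-- The multiplier set `Λ_{x,v}`. -/
def multipliers (ϑ : Y → EReal) (F : X → Y) (x v : X) : Set Y :=
  {ξ | ξ ∈ subdiff ϑ (F x) ∧ ∀ w' : X, inner ℝ v w' ≤ inner ℝ ξ (semideriv F x w')}

/-- The scalarization `ξF : u ↦ ⟨ξ, F u⟩`, as an extended-real-valued function. -/
noncomputable def scalarization (F : X → Y) (ξ : Y) (u : X) : EReal :=
  ((inner ℝ ξ (F u) : ℝ) : EReal)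

/-- The sufficient condition for parabolic regularity: `F` has the (parabolic) semiderivatives
at `x` that occur in it, and for every critical direction `w` there is a multiplier `ξ` with
`inf_z { sup_{u ∈ 𝒜_ϑ(F x, dF(x)(w))} ⟨u, F''(x; w, z)⟩ - ⟨v, z⟩ } = d²(ξF)(x)(w)`. -/
def SuffCondition (ϑ : Y → EReal) (F : X → Y) (x v : X) : Prop :=
  ParabolicallySemidifferentiableAt F x ∧
  ∀ w ∈ criticalCone (fun u => ϑ (F u)) x v, ∃ ξ ∈ multipliers ϑ F x v,
    (⨅ z : X, ((⨆ u ∈ activeSubgrads ϑ (F x) (semideriv F x w),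
        ((inner ℝ u (parSemideriv F x w z) : ℝ) : EReal)) - ((inner ℝ v z : ℝ) : EReal)))
      = subderiv2 (scalarization F ξ) x w

end Maps

end CompositeVA

/-!
Write `y = F x`, `A` and `D` for the first and second derivatives of `F` at `x`, and `f = ϑ ∘ F`.

Near `y` the domain of `ϑ` is `y` plus a finite union of polyhedral cones `T i`, and on each of them
`ϑ (y + u) = ϑ y + a i u + D i u u / 2 + o(‖u‖²)` (`ConicModel`, `IsPWTD.exists_conicModel`).
The values `a i u` and `D i u u` do not depend on the cone containing `u`, and the subderivative of
`ϑ` at `y` is `a i` on `T i` and infinite elsewhere.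

Regularity acts through the epigraph of `ϑ`. A direction that is not tangent to a closed set is
separated by a limiting normal (`exists_mem_normalCone_inner_pos`, from the growth of the distance
function along the ray), so where regular and limiting normals agree, the tangent cone is the polar of the normal cone.
Applied to the epigraph of `ϑ`, this makes the subderivative sublinear (`ConicModel.exists_add`), and
the subgradients of `ϑ` at `y` are the vectors dominated by every `a i` on `T i`.

Let `w` be critical, `u = A w`, `q = D w w`. Every multiplier `ξ` bounds the second subderivative
of `f` for `v` at `w` from below by `D i u u + ⟪ξ, q⟫` (`le_subderiv2For_comp`). Conversely, if
`A z + q` is tangent to `T i` at `u`, then metric subregularity corrects the arc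
`x + τ w + (τ² / 2) z` by `o(τ²)` so that it stays in the domain of `f`; since `ϑ` is Lipschitz on
its domain, the difference quotients along it converge to `D i u u + a i (A z + q) - ⟪v, z⟫`
(`exists_recovery_arc`). The two bounds meet by linear programming duality
(`exists_optimal_multiplier`): the linear program of minimizing `a i (A z + q) - ⟪v, z⟫` is feasible,
again by metric subregularity, bounded below by a given multiplier, and Farkas' lemma turns its
value into a multiplier `ξ`. The same squeeze evaluates the infimum in the sufficient condition and
the infimum of the parabolic subderivatives, and the arcs, being defined for all small `τ`, are
recovery sequences for the epi-convergence.
-/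

namespace CompositeVA

/-! ### One-sided limits and extended-real difference quotients -/

/-- A lower bound on an extended-real difference quotient, with the denominator cleared. -/
lemma coe_le_quot_iff (a : EReal) (r i c : ℝ) {d : ℝ} (hd : 0 < d) :
    (c : EReal) ≤ (a - r - i) / d ↔ ((r + i + c * d : ℝ) : EReal) ≤ a := by
  induction a with
  | bot =>
    rw [EReal.bot_sub, EReal.bot_sub,
      EReal.bot_div_of_pos_ne_top (EReal.coe_pos.2 hd) (EReal.coe_ne_top d)]
    exact iff_of_false (by simp) (by rw [le_bot_iff]; exact EReal.coe_ne_bot _)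
  | top => simp [EReal.top_div_of_pos_ne_top (EReal.coe_pos.2 hd) (EReal.coe_ne_top d)]
  | coe a =>
    rw [← EReal.coe_sub, ← EReal.coe_sub, ← EReal.coe_div, EReal.coe_le_coe_iff,
      EReal.coe_le_coe_iff, le_div_iff₀ hd]
    constructor <;> intro h <;> linarith

lemma tendsto_id_nhdsGT_zero : Tendsto (fun t : ℝ => t) (𝓝[>] (0 : ℝ)) (𝓝 0) :=
  nhdsWithin_le_nhds

lemma tendsto_half_nhdsGT_zero : Tendsto (fun s : ℝ => s / 2) (𝓝[>] 0) (𝓝[>] 0) := by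
  refine tendsto_nhdsWithin_iff.2 ⟨?_, ?_⟩
  · simpa using tendsto_id_nhdsGT_zero.div_const 2
  · filter_upwards [self_mem_nhdsWithin] with s hs using half_pos (Set.mem_Ioi.1 hs)

section General

variable {E : Type*} [NormedAddCommGroup E] [InnerProductSpace ℝ E]

/-! ### Regular subgradients and normals -/

lemma mem_regSubdiff_iff {h : E → EReal} {x v : E} :
    v ∈ regSubdiff h x ↔ h x ≠ ⊥ ∧ h x ≠ ⊤ ∧ ∀ ε : ℝ, 0 < ε → ∀ᶠ x' in 𝓝 x,
      (((h x).toReal + inner ℝ v (x' - x) - ε * ‖x' - x‖ : ℝ) : EReal) ≤ h x' := by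
  refine and_congr_right fun hb => and_congr_right fun ht => ?_
  have hr : h x = ((h x).toReal : EReal) := (EReal.coe_toReal ht hb).symm
  generalize (h x).toReal = r at hr
  rw [hr]
  have key : ∀ (c : ℝ) (x' : E), x' ≠ x → ((c : EReal) ≤
      (h x' - r - ((inner ℝ v (x' - x) : ℝ) : EReal)) / ((‖x' - x‖ : ℝ) : EReal) ↔
      ((r + inner ℝ v (x' - x) + c * ‖x' - x‖ : ℝ) : EReal) ≤ h x') := fun c x' hx' =>
    coe_le_quot_iff _ _ _ _ (norm_pos_iff.2 (sub_ne_zero.2 hx'))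
  constructor
  · intro h0 ε hε
    have h1 : ((-ε : ℝ) : EReal) < liminf (fun x' : E => (h x' - r -
        ((inner ℝ v (x' - x) : ℝ) : EReal)) / ((‖x' - x‖ : ℝ) : EReal)) (𝓝[≠] x) :=
      lt_of_lt_of_le (by exact_mod_cast neg_lt_zero.2 hε) h0
    have h2 := eventually_lt_of_lt_liminf h1
    rw [eventually_nhdsWithin_iff] at h2
    filter_upwards [h2] with x' hx'
    by_cases hxx : x' = x
    · subst hxx; simp [hr]
    · have := (key (-ε) x' hxx).1 (hx' hxx).le
      convert this using 2
      ring
  · intro hε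
    refine le_of_forall_lt fun c hc => ?_
    obtain ⟨b, hcb, hb0⟩ := EReal.lt_iff_exists_real_btwn.1 hc
    refine lt_of_lt_of_le hcb (le_liminf_of_le (by isBoundedDefault) ?_)
    have hb' : (0 : ℝ) < -b := by
      have : b < 0 := by exact_mod_cast hb0
      linarith
    rw [eventually_nhdsWithin_iff]
    filter_upwards [hε (-b) hb'] with x' hx' hne
    rw [key b x' hne]
    convert hx' using 2
    ring

lemma mem_regNormalCone_iff {S : Set E} {x v : E} :
    v ∈ regNormalCone S x ↔ x ∈ S ∧ ∀ ε : ℝ, 0 < ε → ∀ᶠ x' in 𝓝 x, x' ∈ S →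
      inner ℝ v (x' - x) ≤ ε * ‖x' - x‖ := by
  rw [regNormalCone, mem_regSubdiff_iff]
  by_cases hx : x ∈ S
  · simp only [indicatorFn, hx, if_true, ne_eq, EReal.zero_ne_bot, not_false_eq_true,
      EReal.zero_ne_top, EReal.toReal_zero, zero_add, true_and]
    refine forall_congr' fun ε => forall_congr' fun _ => eventually_congr (.of_forall fun x' => ?_)
    by_cases hx' : x' ∈ S
    · simp only [hx', if_true, forall_true_left]
      rw [← EReal.coe_zero, EReal.coe_le_coe_iff, sub_nonpos]
    · simp [hx']
  · simp [indicatorFn, hx]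

lemma mem_normalCone_of_tendsto {S : Set E} {x v : E} (hx : x ∈ S) {xs vs : ℕ → E}
    (hxs : Tendsto xs atTop (𝓝 x)) (hvs : ∀ k, vs k ∈ regNormalCone S (xs k))
    (hv : Tendsto vs atTop (𝓝 v)) : v ∈ normalCone S x := by
  refine ⟨by simp [indicatorFn, hx], by simp [indicatorFn, hx], xs, vs, hxs, ?_, hvs, hv⟩
  have h1 : ∀ k, xs k ∈ S := fun k => (mem_regNormalCone_iff.1 (hvs k)).1
  simp [indicatorFn, hx, h1]

/-- Regular normals make an obtuse angle with every one-sided derivative of a curve in the set. -/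
lemma inner_nonpos_of_mem_regNormalCone {S : Set E} {x n d : E} (hn : n ∈ regNormalCone S x)
    {P : ℝ → E} (hP : ∀ᶠ t in 𝓝[>] (0 : ℝ), x + t • P t ∈ S)
    (hd : Tendsto P (𝓝[>] (0 : ℝ)) (𝓝 d)) : inner ℝ n d ≤ 0 := by
  obtain ⟨hx, h⟩ := mem_regNormalCone_iff.1 hn
  have ht0 := tendsto_id_nhdsGT_zero
  have hcurve : Tendsto (fun t : ℝ => x + t • P t) (𝓝[>] (0 : ℝ)) (𝓝 x) := by
    simpa using tendsto_const_nhds.add (ht0.smul hd)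
  have key : ∀ ε : ℝ, 0 < ε → inner ℝ n d ≤ ε * ‖d‖ := by
    intro ε hε
    refine le_of_tendsto_of_tendsto (tendsto_const_nhds.inner hd) (hd.norm.const_mul ε) ?_
    filter_upwards [hP, hcurve.eventually (h ε hε), self_mem_nhdsWithin] with t h1 h2 ht
    have ht : 0 < t := ht
    have h3 := h2 h1
    rw [add_sub_cancel_left, inner_smul_right, norm_smul, Real.norm_of_nonneg ht.le,
      mul_left_comm] at h3
    exact le_of_mul_le_mul_left h3 ht
  have hlim : Tendsto (fun ε : ℝ => ε * ‖d‖) (𝓝[>] (0 : ℝ)) (𝓝 0) := by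
    simpa using ht0.mul_const ‖d‖
  exact ge_of_tendsto hlim (by filter_upwards [self_mem_nhdsWithin] with ε hε using key ε hε)

/-- If the distance from `x + t p` to `S` grows at least linearly in `t`, then some proximal normal
at a point of `S` arbitrarily close to `x` makes an acute angle with `p`, by an amount independent
of the point. -/
lemma exists_proximal_normal [FiniteDimensional ℝ E] {S : Set E} (hS : IsClosed S) {x p : E}
    (hx : x ∈ S) {δ t₀ : ℝ} (hδ : 0 < δ)
    (hd : ∀ t, 0 < t → t < t₀ → ∀ s ∈ S, δ * t ≤ ‖x + t • p - s‖) {ε : ℝ} (hε : 0 < ε)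
    (hεt : ε < t₀) :
    ∃ q n : E, n ∈ regNormalCone S q ∧ ‖n‖ = 1 ∧ ‖q - x‖ ≤ 2 * (ε * ‖p‖) ∧
      δ / 2 ≤ inner ℝ n p := by
  set d : ℝ → ℝ := fun t => Metric.infDist (x + t • p) S with hd_def
  have hne : S.Nonempty := ⟨x, hx⟩
  have hdc : Continuous d := (Metric.continuous_infDist_pt S).comp (by fun_prop)
  have hdlow : ∀ t, 0 < t → t < t₀ → δ * t ≤ d t := fun t h1 h2 => by
    obtain ⟨s, hs, hds⟩ := hS.exists_infDist_eq_dist hne (x + t • p)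
    simp only [hd_def, hds, dist_eq_norm]
    exact hd t h1 h2 s hs
  have hdup : ∀ t, 0 ≤ t → d t ≤ t * ‖p‖ := fun t ht => by
    refine (Metric.infDist_le_dist_of_mem hx).trans ?_
    rw [dist_eq_norm, add_sub_cancel_left, norm_smul, Real.norm_of_nonneg ht]
  -- a left end point so close to `0` that the minimum below is not attained at `ε`
  obtain ⟨η, hη0, hηε, hηp⟩ : ∃ η : ℝ, 0 < η ∧ η < ε ∧ η * ‖p‖ < δ * ε / 2 := by
    have h1 : Tendsto (fun η : ℝ => η * ‖p‖) (𝓝[>] 0) (𝓝 0) := by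
      simpa using tendsto_id_nhdsGT_zero.mul_const ‖p‖
    have h2 : ∀ᶠ η in 𝓝[>] (0 : ℝ), η < ε := nhdsWithin_le_nhds (Iio_mem_nhds hε)
    have h3 := h1.eventually (Iio_mem_nhds (show (0 : ℝ) < δ * ε / 2 by positivity))
    obtain ⟨η, h4, h5, h6⟩ := ((eventually_mem_nhdsWithin (a := (0 : ℝ))).and (h2.and h3)).exists
    exact ⟨η, h4, h5, h6⟩
  obtain ⟨s, hs, hmin⟩ := isCompact_Icc.exists_isMinOn (Set.nonempty_Icc.2 hηε.le)
    (f := fun t => d t - δ / 2 * t) (by fun_prop)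
  have hs0 : 0 < s := hη0.trans_le hs.1
  have hsε : s < ε := by
    refine lt_of_le_of_ne hs.2 fun h => ?_
    have h1 : d s - δ / 2 * s ≤ d η - δ / 2 * η := hmin (Set.left_mem_Icc.2 hηε.le)
    rw [h] at h1
    have h2 := hdlow ε hε hεt
    have h3 := hdup η hη0.le
    nlinarith [mul_pos hδ hη0]
  obtain ⟨q, hq, hqd⟩ := hS.exists_infDist_eq_dist hne (x + s • p)
  set n₀ := x + s • p - q with hn₀
  have hn₀d : ‖n₀‖ = d s := by rw [hn₀, ← dist_eq_norm, ← hqd]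
  have hn₀pos : 0 < ‖n₀‖ := by
    rw [hn₀d]; exact lt_of_lt_of_le (mul_pos hδ hs0) (hdlow s hs0 (hsε.trans hεt))
  have hgrow : ∀ h : ℝ, 0 < h → h ≤ ε - s → δ * ‖n₀‖ ≤ 2 * inner ℝ n₀ p + h * ‖p‖ ^ 2 := by
    intro h h0 h1
    have h2 : d s - δ / 2 * s ≤ d (s + h) - δ / 2 * (s + h) :=
      hmin ⟨by linarith [hs.1], by linarith⟩
    have h3 : d (s + h) ≤ ‖n₀ + h • p‖ := by
      refine (Metric.infDist_le_dist_of_mem hq).trans_eq ?_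
      rw [dist_eq_norm, hn₀]; congr 1; module
    have h4 : ‖n₀‖ + δ / 2 * h ≤ ‖n₀ + h • p‖ := by rw [hn₀d]; linarith
    have h5 : (‖n₀‖ + δ / 2 * h) ^ 2 ≤ ‖n₀ + h • p‖ ^ 2 := by gcongr
    rw [norm_add_sq_real, inner_smul_right, norm_smul, Real.norm_of_nonneg h0.le] at h5
    have h6 : h * (δ * ‖n₀‖) ≤ h * (2 * inner ℝ n₀ p + h * ‖p‖ ^ 2) := by nlinarith [sq_nonneg (δ / 2 * h)]
    exact le_of_mul_le_mul_left h6 h0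
  have hang : δ * ‖n₀‖ ≤ 2 * inner ℝ n₀ p := by
    have hl : Tendsto (fun h : ℝ => 2 * inner ℝ n₀ p + h * ‖p‖ ^ 2) (𝓝[>] 0)
        (𝓝 (2 * inner ℝ n₀ p)) := by
      simpa using tendsto_const_nhds.add
        (tendsto_id_nhdsGT_zero.mul_const (‖p‖ ^ 2))
    refine ge_of_tendsto hl ?_
    filter_upwards [self_mem_nhdsWithin, nhdsWithin_le_nhds (Iic_mem_nhds (sub_pos.2 hsε))]
      with h h0 h1 using hgrow h h0 h1
  refine ⟨q, ‖n₀‖⁻¹ • n₀, ?_, ?_, ?_, ?_⟩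
  · rw [mem_regNormalCone_iff]
    refine ⟨hq, fun e he => ?_⟩
    filter_upwards [Metric.ball_mem_nhds q (show 0 < e * ‖n₀‖ by positivity)] with s' hs' hs'S
    rw [Metric.mem_ball, dist_eq_norm] at hs'
    have h1 : ‖n₀‖ ≤ ‖n₀ - (s' - q)‖ := by
      rw [hn₀d]
      refine (Metric.infDist_le_dist_of_mem hs'S).trans_eq ?_
      rw [dist_eq_norm, hn₀]; congr 1; abel
    have h2 : ‖n₀‖ ^ 2 ≤ ‖n₀ - (s' - q)‖ ^ 2 := by gcongr
    rw [norm_sub_sq_real n₀ (s' - q)] at h2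
    rw [real_inner_smul_left, inv_mul_le_iff₀ hn₀pos]
    nlinarith [norm_nonneg (s' - q)]
  · rw [norm_smul, norm_inv, norm_norm, inv_mul_cancel₀ hn₀pos.ne']
  · have h1 : ‖q - x‖ ≤ ‖n₀‖ + ‖s • p‖ := by
      have : q - x = s • p - n₀ := by rw [hn₀]; abel
      rw [this, add_comm]; exact norm_sub_le _ _
    have h2 := hdup s hs0.le
    rw [norm_smul, Real.norm_of_nonneg hs0.le, hn₀d] at h1
    have h3 : s * ‖p‖ ≤ ε * ‖p‖ := by gcongr
    linarith
  · rw [real_inner_smul_left, inv_mul_eq_div, le_div_iff₀ hn₀pos]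
    linarith

/-- A direction that is not tangent to a closed set is separated from the origin by a limiting
normal. -/
lemma exists_mem_normalCone_inner_pos [FiniteDimensional ℝ E] {S : Set E} (hS : IsClosed S)
    {x p : E} (hx : x ∈ S) {δ t₀ : ℝ} (hδ : 0 < δ) (ht₀ : 0 < t₀)
    (hd : ∀ t, 0 < t → t < t₀ → ∀ s ∈ S, δ * t ≤ ‖x + t • p - s‖) :
    ∃ n ∈ normalCone S x, 0 < inner ℝ n p := by
  have hε : ∀ k : ℕ, 0 < t₀ / (k + 2) := fun k => by positivity
  have hεt : ∀ k : ℕ, t₀ / (k + 2) < t₀ := fun k => by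
    rw [div_lt_iff₀ (by positivity)]
    nlinarith [(Nat.cast_nonneg k : (0 : ℝ) ≤ k)]
  choose q n hn hn1 hq hp using fun k => exists_proximal_normal hS hx hδ hd (hε k) (hεt k)
  obtain ⟨n', -, σ, hσ, hlim⟩ := (isCompact_sphere (0 : E) 1).tendsto_subseq
    (x := n) (fun k => by simp [hn1 k])
  refine ⟨n', mem_normalCone_of_tendsto hx (xs := q ∘ σ) (vs := n ∘ σ) ?_ (fun k => hn _) hlim, ?_⟩
  · refine Tendsto.comp ?_ hσ.tendsto_atTop
    rw [tendsto_iff_norm_sub_tendsto_zero]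
    refine squeeze_zero (fun _ => norm_nonneg _) hq ?_
    have h1 : Tendsto (fun k : ℕ => t₀ / ((k : ℝ) + 2)) atTop (𝓝 0) :=
      tendsto_const_nhds.div_atTop
        (tendsto_atTop_add_const_right _ _ tendsto_natCast_atTop_atTop)
    simpa using (h1.mul_const ‖p‖).const_mul 2
  · exact lt_of_lt_of_le (half_pos hδ)
      (ge_of_tendsto' (hlim.inner tendsto_const_nhds) fun k => hp _)

/-- The epigraph as a subset of the Hilbert space `E × ℝ`. -/
abbrev epiL2 (h : E → EReal) : Set (WithLp 2 (E × ℝ)) := {p | WithLp.ofLp p ∈ epi h}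

/-- A regular subgradient `v` gives the regular normal `(v, -1)` to the epigraph. -/
lemma regSubdiff_to_regNormalCone {h : E → EReal} {x v : E} (hv : v ∈ regSubdiff h x) :
    WithLp.toLp 2 (v, (-1 : ℝ)) ∈
      regNormalCone (epiL2 h) (WithLp.toLp 2 (x, (h x).toReal)) := by
  obtain ⟨hb, ht, hε⟩ := mem_regSubdiff_iff.1 hv
  rw [mem_regNormalCone_iff]
  refine ⟨by simp [epi, EReal.coe_toReal ht hb], fun ε he => ?_⟩
  have hfst : Tendsto (fun p : WithLp 2 (E × ℝ) => (WithLp.ofLp p).1)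
      (𝓝 (WithLp.toLp 2 (x, (h x).toReal))) (𝓝 x) :=
    (continuous_fst.comp (WithLp.prod_continuous_ofLp 2 E ℝ)).tendsto' _ _ rfl
  filter_upwards [hfst.eventually (hε ε he)] with p hp hpS
  have h1 := hp.trans hpS
  rw [EReal.coe_le_coe_iff] at h1
  have h2 : ‖(WithLp.ofLp p).1 - x‖ ≤ ‖p - WithLp.toLp 2 (x, (h x).toReal)‖ := by
    rw [WithLp.prod_norm_eq_of_L2]
    refine Real.le_sqrt_of_sq_le ?_
    simpa using sq_nonneg _
  rw [WithLp.prod_inner_apply]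
  simp only [WithLp.ofLp_sub, Prod.fst_sub, Prod.snd_sub]
  have h3 : inner ℝ (-1 : ℝ) ((WithLp.ofLp p).2 - (h x).toReal) =
      -((WithLp.ofLp p).2 - (h x).toReal) := by simp
  rw [h3]
  nlinarith

lemma subdiff_to_normalCone {h : E → EReal} {x v : E} (hv : v ∈ subdiff h x) :
    WithLp.toLp 2 (v, (-1 : ℝ)) ∈
      normalCone (epiL2 h) (WithLp.toLp 2 (x, (h x).toReal)) := by
  obtain ⟨hb, ht, xs, vs, hxs, hh, hvs, hlim⟩ := hv
  refine mem_normalCone_of_tendsto (by simp [epi, EReal.coe_toReal ht hb])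
    (xs := fun k => WithLp.toLp 2 (xs k, (h (xs k)).toReal))
    (vs := fun k => WithLp.toLp 2 (vs k, (-1 : ℝ))) ?_
    (fun k => regSubdiff_to_regNormalCone (hvs k)) ?_
  · exact ((WithLp.prod_continuous_toLp 2 E ℝ).tendsto _).comp
      (hxs.prodMk_nhds ((EReal.tendsto_toReal ht hb).comp hh))
  · exact ((WithLp.prod_continuous_toLp 2 E ℝ).tendsto _).comp (hlim.prodMk_nhds tendsto_const_nhds)

lemma regSubdiff_subset_subdiff {h : E → EReal} {x : E} : regSubdiff h x ⊆ subdiff h x :=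
  fun v hv => ⟨hv.1, hv.2.1, fun _ => x, fun _ => v, tendsto_const_nhds, tendsto_const_nhds,
    fun _ => hv, tendsto_const_nhds⟩

end General

section Taylor

variable {E G : Type*} [NormedAddCommGroup E] [InnerProductSpace ℝ E]
  [NormedAddCommGroup G] [InnerProductSpace ℝ G]

/-! ### Second-order expansions -/

/-- The mapping `g` has the second-order Peano expansion at `x` with derivative `A` and second
derivative `D`; symmetry of `D` plays no role. -/
def HasTaylorTwo (g : E → G) (x : E) (A : E →L[ℝ] G) (D : E →L[ℝ] E →L[ℝ] G) : Prop :=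
  (fun h => g (x + h) - g x - A h - (1 / 2 : ℝ) • D h h) =o[𝓝 0] fun h => ‖h‖ ^ 2

lemma TwiceDifferentiableOn.hasTaylorTwo {g : E → G} {U : Set E} (hg : TwiceDifferentiableOn g U)
    (hU : IsOpen U) {x : E} (hx : x ∈ U) :
    HasTaylorTwo g x (fderiv ℝ g x) (fderiv ℝ (fderiv ℝ g) x) := by
  set A := fderiv ℝ g x
  set D := fderiv ℝ (fderiv ℝ g) x with hD
  have hD' : HasFDerivAt (fderiv ℝ g) D x :=
    ((hg.2 x hx).differentiableAt (hU.mem_nhds hx)).hasFDerivAt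
  rw [hasFDerivAt_iff_isLittleO_nhds_zero] at hD'
  rw [HasTaylorTwo, Asymptotics.isLittleO_iff]
  intro c hc
  have hUx : ∀ᶠ h in 𝓝 (0 : E), x + h ∈ U := by
    have : Tendsto (fun h : E => x + h) (𝓝 0) (𝓝 x) := by
      exact (continuous_const.add continuous_id).tendsto' _ _ (by simp)
    exact this.eventually (hU.mem_nhds hx)
  obtain ⟨r, hr, hball⟩ := Metric.eventually_nhds_iff_ball.1 (hUx.and (hD'.bound hc))
  filter_upwards [Metric.ball_mem_nhds (0 : E) hr] with h hh
  rw [mem_ball_zero_iff] at hh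
  have hth : ∀ t ∈ Set.Icc (0 : ℝ) 1, t • h ∈ Metric.ball (0 : E) r := fun t ht => by
    rw [mem_ball_zero_iff, norm_smul, Real.norm_of_nonneg ht.1]
    exact lt_of_le_of_lt (mul_le_of_le_one_left (norm_nonneg h) ht.2) hh
  have hderiv : ∀ t ∈ Set.Icc (0 : ℝ) 1, HasDerivWithinAt
      (fun t : ℝ => g (x + t • h) - t • A h - (t ^ 2 / 2) • D h h)
      ((fderiv ℝ g (x + t • h) - A - D (t • h)) h) (Set.Icc 0 1) t := by
    intro t ht
    have h1 : HasFDerivAt g (fderiv ℝ g (x + t • h)) (x + t • h) :=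
      ((hg.1 _ (hball _ (hth t ht)).1).differentiableAt
        (hU.mem_nhds (hball _ (hth t ht)).1)).hasFDerivAt
    have h2 : HasDerivAt (fun t : ℝ => x + t • h) h t := by
      simpa using ((hasDerivAt_id t).smul_const h).const_add x
    have h3 := h1.comp_hasDerivAt t h2
    have h4 : HasDerivAt (fun t : ℝ => t • A h) (A h) t := by
      simpa using (hasDerivAt_id t).smul_const (A h)
    have h5 : HasDerivAt (fun t : ℝ => (t ^ 2 / 2) • D h h) (t • D h h) t := by
      have := (((hasDerivAt_id t).pow 2).div_const 2).smul_const (D h h)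
      refine this.congr_deriv ?_
      congr 1
      simp
    refine (((h3.sub h4).sub h5).congr_deriv ?_).hasDerivWithinAt
    simp
  have hbound : ∀ t ∈ Set.Ico (0 : ℝ) 1,
      ‖(fderiv ℝ g (x + t • h) - A - D (t • h)) h‖ ≤ c * ‖h‖ ^ 2 := by
    intro t ht
    have ht' : t ∈ Set.Icc (0 : ℝ) 1 := ⟨ht.1, ht.2.le⟩
    calc ‖(fderiv ℝ g (x + t • h) - A - D (t • h)) h‖
        ≤ ‖fderiv ℝ g (x + t • h) - A - D (t • h)‖ * ‖h‖ := ContinuousLinearMap.le_opNorm _ _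
      _ ≤ (c * ‖t • h‖) * ‖h‖ := by gcongr; exact (hball _ (hth t ht')).2
      _ ≤ (c * ‖h‖) * ‖h‖ := by
          gcongr
          rw [norm_smul, Real.norm_of_nonneg ht.1]
          exact mul_le_of_le_one_left (norm_nonneg h) ht.2.le
      _ = c * ‖h‖ ^ 2 := by ring
  have := norm_image_sub_le_of_norm_deriv_le_segment_01' hderiv hbound
  simp only [one_smul, zero_smul, add_zero, sub_zero, one_pow] at this
  rw [norm_pow, norm_norm]
  convert this using 2
  simp only [ne_eq, OfNat.ofNat_ne_zero, not_false_eq_true, zero_pow, zero_div, zero_smul, sub_zero]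
  abel

variable {g : E → G} {x : E} {A : E →L[ℝ] G} {D : E →L[ℝ] E →L[ℝ] G}

/-- The second-order difference quotients converge along `τ ↓ 0`, `w' → w`. -/
lemma HasTaylorTwo.tendsto_quot (hg : HasTaylorTwo g x A D) (w : E) :
    Tendsto (fun p : ℝ × E => (p.1 ^ 2 / 2)⁻¹ • (g (x + p.1 • p.2) - g x - p.1 • A p.2))
      (𝓝[>] (0 : ℝ) ×ˢ 𝓝 w) (𝓝 (D w w)) := by
  set l := 𝓝[>] (0 : ℝ) ×ˢ 𝓝 w
  have h1 : Tendsto (fun p : ℝ × E => p.1) l (𝓝[>] 0) := tendsto_fst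
  have h1' : Tendsto (fun p : ℝ × E => p.1) l (𝓝 0) := h1.mono_right nhdsWithin_le_nhds
  have h2 : Tendsto (fun p : ℝ × E => p.2) l (𝓝 w) := tendsto_snd
  have hpos : ∀ᶠ p : ℝ × E in l, 0 < p.1 := h1.eventually self_mem_nhdsWithin
  have h3 : Tendsto (fun p : ℝ × E => p.1 • p.2) l (𝓝 0) := by simpa using h1'.smul h2
  have hO : (fun p : ℝ × E => ‖p.1 • p.2‖ ^ 2) =O[l] fun p => p.1 ^ 2 / 2 := by
    have hb : (fun p : ℝ × E => p.2) =O[l] fun _ => (1 : ℝ) := h2.isBigO_one ℝ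
    have h4 := ((Asymptotics.isBigO_refl (fun p : ℝ × E => p.1) l).smul hb).norm_left.pow 2
    refine h4.trans (.of_bound 2 (.of_forall fun p => ?_))
    simp only [smul_eq_mul, mul_one, norm_div, norm_pow, Real.norm_ofNat]
    linarith
  have h5 := ((hg.comp_tendsto h3).trans_isBigO hO).tendsto_inv_smul_nhds_zero
  have h6 : Tendsto (fun p : ℝ × E => D p.2 p.2) l (𝓝 (D w w)) :=
    (((by fun_prop : Continuous fun w' : E => D w' w').tendsto w).comp h2)
  have h7 := h5.add h6
  rw [zero_add] at h7
  refine h7.congr' ?_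
  filter_upwards [hpos] with p hp
  have hne : p.1 ^ 2 / 2 ≠ 0 := by positivity
  simp only [Function.comp_apply, map_smul, smul_apply, smul_sub, smul_smul]
  have : (p.1 ^ 2 / 2)⁻¹ * (1 / 2 * (p.1 * p.1)) = 1 := by field_simp
  rw [this, one_smul]
  abel

lemma HasTaylorTwo.hasSemideriv (hg : HasTaylorTwo g x A D) (w : E) :
    HasSemideriv g x w (A w) := by
  rw [HasSemideriv]
  have h1 : Tendsto (fun p : ℝ × E => p.1) (𝓝[>] (0 : ℝ) ×ˢ 𝓝 w) (𝓝 0) :=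
    tendsto_fst.mono_right nhdsWithin_le_nhds
  have h2 : Tendsto (fun p : ℝ × E => A p.2) (𝓝[>] (0 : ℝ) ×ˢ 𝓝 w) (𝓝 (A w)) :=
    (A.continuous.tendsto w).comp tendsto_snd
  have h3 := h2.add ((h1.div_const 2).smul (hg.tendsto_quot w))
  rw [zero_div, zero_smul, add_zero] at h3
  refine h3.congr' ?_
  filter_upwards [(tendsto_fst : Tendsto _ (𝓝[>] (0 : ℝ) ×ˢ 𝓝 w) _).eventually
    self_mem_nhdsWithin] with p hp
  have hp : 0 < p.1 := hp
  have h4 : p.1 / 2 * (p.1 ^ 2 / 2)⁻¹ = p.1⁻¹ := by field_simp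
  rw [smul_smul, h4, smul_sub, smul_smul, inv_mul_cancel₀ hp.ne', one_smul]
  abel

lemma HasTaylorTwo.semideriv_eq (hg : HasTaylorTwo g x A D) (w : E) : semideriv g x w = A w :=
  (hg.hasSemideriv w).limUnder_eq

/-- Moving along a parabolic arc amounts to perturbing the direction by a first-order term. -/
lemma tendsto_parabolic_direction (w z : E) :
    Tendsto (fun p : ℝ × E => (p.1, w + (p.1 / 2) • p.2)) (𝓝[>] (0 : ℝ) ×ˢ 𝓝 z)
      (𝓝[>] (0 : ℝ) ×ˢ 𝓝 w) := by
  refine tendsto_fst.prodMk ?_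
  have h1 : Tendsto (fun p : ℝ × E => p.1 / 2) (𝓝[>] (0 : ℝ) ×ˢ 𝓝 z) (𝓝 0) := by
    have : Tendsto (fun p : ℝ × E => p.1) (𝓝[>] (0 : ℝ) ×ˢ 𝓝 z) (𝓝 0) :=
      tendsto_fst.mono_right nhdsWithin_le_nhds
    simpa using this.div_const 2
  simpa using tendsto_const_nhds.add (h1.smul tendsto_snd)

lemma parabolic_arc_eq (x w z : E) (τ : ℝ) :
    x + τ • w + (τ ^ 2 / 2) • z = x + τ • (w + (τ / 2) • z) := by
  module

lemma HasTaylorTwo.tendsto_parQuot (hg : HasTaylorTwo g x A D) (w z : E) :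
    Tendsto (parQuot g x w) (𝓝[>] (0 : ℝ) ×ˢ 𝓝 z) (𝓝 (A z + D w w)) := by
  have h1 := (hg.tendsto_quot w).comp (tendsto_parabolic_direction w z)
  have h2 : Tendsto (fun p : ℝ × E => A p.2) (𝓝[>] (0 : ℝ) ×ˢ 𝓝 z) (𝓝 (A z)) :=
    (A.continuous.tendsto z).comp tendsto_snd
  refine (h2.add h1).congr' ?_
  filter_upwards [(tendsto_fst : Tendsto _ (𝓝[>] (0 : ℝ) ×ˢ 𝓝 z) _).eventually
    self_mem_nhdsWithin] with p hp
  have hp : 0 < p.1 := hp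
  have hne : p.1 ^ 2 / 2 ≠ 0 := by positivity
  rw [parQuot, hg.semideriv_eq, parabolic_arc_eq, Function.comp_apply]
  simp only [map_add, map_smul]
  have hk : (p.1 ^ 2 / 2)⁻¹ * (p.1 * (p.1 / 2)) = 1 := by field_simp
  simp only [smul_sub, smul_add, smul_smul, hk, one_smul]
  abel

lemma HasTaylorTwo.parSemideriv_eq (hg : HasTaylorTwo g x A D) (w z : E) :
    parSemideriv g x w z = A z + D w w :=
  (hg.tendsto_parQuot w z).limUnder_eq

lemma HasTaylorTwo.parabolicallySemidifferentiableAt (hg : HasTaylorTwo g x A D) :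
    ParabolicallySemidifferentiableAt g x :=
  fun w => ⟨⟨_, hg.hasSemideriv w⟩, fun z => ⟨_, hg.tendsto_parQuot w z⟩⟩

lemma liminf_coe_eq {ι : Type*} {l : Filter ι} [l.NeBot] {φ : ι → ℝ} {a : ℝ}
    (h : Tendsto φ l (𝓝 a)) : liminf (fun i => (φ i : EReal)) l = a :=
  ((continuous_coe_real_ereal.tendsto a).comp h).liminf_eq

lemma HasTaylorTwo.subderiv_scalarization (hg : HasTaylorTwo g x A D) (ξ : G) (w : E) :
    subderiv (scalarization g ξ) x w = ((inner ℝ ξ (A w) : ℝ) : EReal) := by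
  have h : Tendsto (fun p : ℝ × E => (inner ℝ ξ (g (x + p.1 • p.2)) - inner ℝ ξ (g x)) / p.1)
      (𝓝[>] (0 : ℝ) ×ˢ 𝓝 w) (𝓝 (inner ℝ ξ (A w))) := by
    refine (tendsto_const_nhds.inner (hg.hasSemideriv w)).congr fun p => ?_
    rw [inner_smul_right, inner_sub_right]; ring
  rw [← liminf_coe_eq h]
  simp only [subderiv, scalarization, EReal.coe_div, EReal.coe_sub]

lemma HasTaylorTwo.subderiv2_scalarization (hg : HasTaylorTwo g x A D) (ξ : G) (w : E) :
    subderiv2 (scalarization g ξ) x w = ((inner ℝ ξ (D w w) : ℝ) : EReal) := by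
  have h : Tendsto (fun p : ℝ × E => (inner ℝ ξ (g (x + p.1 • p.2)) - inner ℝ ξ (g x) -
      p.1 * inner ℝ ξ (A p.2)) / (p.1 ^ 2 / 2))
      (𝓝[>] (0 : ℝ) ×ˢ 𝓝 w) (𝓝 (inner ℝ ξ (D w w))) := by
    refine (tendsto_const_nhds.inner (hg.tendsto_quot w)).congr fun p => ?_
    rw [inner_smul_right, inner_sub_right, inner_sub_right, inner_smul_right]; ring
  rw [← liminf_coe_eq h, subderiv2]
  congr 1
  funext p
  rw [quot2, hg.subderiv_scalarization, if_neg (by simp)]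
  simp only [scalarization, EReal.coe_div, EReal.coe_sub, EReal.coe_mul]

end Taylor

/-! ### Linear programming duality -/

/-- **Farkas' lemma** for finitely many inequality constraints `ψ i ≤ 0` and equality constraints
`L = 0`: a linear functional that is nonpositive on the feasible cone is dominated, on the cone of
the inequality constraints, by a functional of `L`. The induction on the number of constraints is
Bartl's and needs no topology. -/
lemma exists_dominating_functional {V W κ : Type*} [AddCommGroup V] [Module ℝ V] [AddCommGroup W]
    [Module ℝ W] (L : V →ₗ[ℝ] W) (s : Finset κ) (ψ : κ → V →ₗ[ℝ] ℝ) (φ : V →ₗ[ℝ] ℝ)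
    (h : ∀ x, L x = 0 → (∀ i ∈ s, ψ i x ≤ 0) → φ x ≤ 0) :
    ∃ ξ : W →ₗ[ℝ] ℝ, ∀ x, (∀ i ∈ s, ψ i x ≤ 0) → φ x ≤ ξ (L x) := by
  classical
  induction s using Finset.induction_on generalizing ψ φ with
  | empty =>
    have hker : LinearMap.ker L ≤ LinearMap.ker φ := fun x hx => by
      rw [LinearMap.mem_ker] at hx ⊢
      refine le_antisymm (h x hx (by simp)) ?_
      have := h (-x) (by simp [hx]) (by simp)
      simpa using this
    obtain ⟨ξ, hξ⟩ := LinearMap.exists_extend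
      (((LinearMap.ker L).liftQ φ hker).comp L.quotKerEquivRange.symm.toLinearMap)
    refine ⟨ξ, fun x _ => le_of_eq ?_⟩
    have h1 := LinearMap.congr_fun hξ ⟨L x, LinearMap.mem_range_self L x⟩
    have h2 : L.quotKerEquivRange.symm ⟨L x, LinearMap.mem_range_self L x⟩ =
        (LinearMap.ker L).mkQ x := L.quotKerEquivRange_symm_apply_image x _
    simp only [LinearMap.comp_apply, Submodule.subtype_apply, LinearEquiv.coe_coe, h2,
      Submodule.mkQ_apply, Submodule.liftQ_apply] at h1
    exact h1.symm
  | insert i₀ s hi₀ ih =>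
    by_cases hcase : ∀ x, L x = 0 → (∀ i ∈ s, ψ i x ≤ 0) → φ x ≤ 0
    · obtain ⟨ξ, hξ⟩ := ih ψ φ hcase
      exact ⟨ξ, fun x hx => hξ x fun i hi => hx i (Finset.mem_insert_of_mem hi)⟩
    · push Not at hcase
      obtain ⟨x₁, hL₁, hψ₁, hφ₁⟩ := hcase
      have hpos : 0 < ψ i₀ x₁ := by
        by_contra hle
        refine absurd (h x₁ hL₁ fun i hi => ?_) (not_le.2 hφ₁)
        rcases Finset.mem_insert.1 hi with rfl | hi
        exacts [not_lt.1 hle, hψ₁ i hi]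
      -- eliminate along `x₁`, rescaled so that `ψ i₀` takes the value `1` there
      set x' := (ψ i₀ x₁)⁻¹ • x₁ with hx'
      have hL' : L x' = 0 := by simp [hx', hL₁]
      have h1' : ψ i₀ x' = 1 := by simp [hx', hpos.ne']
      have hψ' : ∀ i ∈ s, ψ i x' ≤ 0 := fun i hi => by
        simp only [hx', map_smul, smul_eq_mul]
        exact mul_nonpos_of_nonneg_of_nonpos (inv_nonneg.2 hpos.le) (hψ₁ i hi)
      have hφ' : 0 < φ x' := by
        simp only [hx', map_smul, smul_eq_mul]
        exact mul_pos (inv_pos.2 hpos) hφ₁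
      obtain ⟨ξ, hξ⟩ := ih (fun i => ψ i - ψ i x' • ψ i₀) (φ - φ x' • ψ i₀) (by
        intro x hLx hx
        have := h (x - ψ i₀ x • x') (by simp [hLx, hL']) (by
          intro i hi
          rcases Finset.mem_insert.1 hi with rfl | hi
          · simp [h1']
          · have := hx i hi
            simp only [LinearMap.sub_apply, LinearMap.smul_apply, smul_eq_mul, map_sub,
              map_smul] at this ⊢
            linarith)
        simp only [LinearMap.sub_apply, LinearMap.smul_apply, smul_eq_mul, map_sub,
          map_smul] at this ⊢
        linarith)
      refine ⟨ξ, fun x hx => ?_⟩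
      have h0 := hx i₀ (Finset.mem_insert_self _ _)
      have := hξ (x - ψ i₀ x • x') (by
        intro i hi
        have h2 := hx i (Finset.mem_insert_of_mem hi)
        have h3 := hψ' i hi
        simp only [LinearMap.sub_apply, LinearMap.smul_apply, smul_eq_mul, map_sub, map_smul, h1']
        nlinarith)
      simp only [LinearMap.sub_apply, LinearMap.smul_apply, smul_eq_mul, map_sub, map_smul, h1',
        hL', smul_zero, sub_zero] at this
      nlinarith

section Duality

variable {X Y : Type*} [NormedAddCommGroup X] [InnerProductSpace ℝ X]
  [NormedAddCommGroup Y] [InnerProductSpace ℝ Y] [FiniteDimensional ℝ Y]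

/-- The polyhedral cone with the finite set `N` of outer normals. -/
def polyCone (N : Finset Y) : Set Y := {u | ∀ n ∈ N, inner ℝ n u ≤ 0}

/-- Duality for the linear program `min (∑ a i (p i) - ⟪v, z⟫)` over `p i ∈ polyCone (N i)` and `z`
with `∑ p i = A z + q`. The hypothesis homogenizes the lower bound `c` on its value; the conclusion
is a dual feasible point of value at least `c`. -/
lemma exists_dual_feasible {ι : Type*} [Fintype ι] (N : ι → Finset Y) (a : ι → Y →L[ℝ] ℝ)
    (A : X →L[ℝ] Y) (v : X) (q : Y) (c : ℝ)
    (h : ∀ p : ι → Y, (∀ i, p i ∈ polyCone (N i)) → ∀ (z : X) (μ : ℝ), 0 ≤ μ →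
      ∑ i, p i = A z + μ • q → inner ℝ v z + μ * c ≤ ∑ i, a i (p i)) :
    ∃ ξ : Y, (∀ i, ∀ p ∈ polyCone (N i), inner ℝ ξ p ≤ a i p) ∧
      (∀ z, inner ℝ ξ (A z) = inner ℝ v z) ∧ c ≤ inner ℝ ξ q := by
  classical
  let pr : ι → (ι → Y) × X × ℝ →ₗ[ℝ] Y := fun i => LinearMap.proj i ∘ₗ LinearMap.fst ℝ _ _
  let zz : (ι → Y) × X × ℝ →ₗ[ℝ] X := LinearMap.fst ℝ _ _ ∘ₗ LinearMap.snd ℝ _ _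
  let mm : (ι → Y) × X × ℝ →ₗ[ℝ] ℝ := LinearMap.snd ℝ _ _ ∘ₗ LinearMap.snd ℝ _ _
  let L : (ι → Y) × X × ℝ →ₗ[ℝ] Y := ∑ i, pr i - A.toLinearMap ∘ₗ zz - mm.smulRight q
  let φ : (ι → Y) × X × ℝ →ₗ[ℝ] ℝ := (innerₗ X v) ∘ₗ zz + c • mm - ∑ i, (a i).toLinearMap ∘ₗ pr i
  let ψ : Option (Σ i, {n // n ∈ N i}) → (ι → Y) × X × ℝ →ₗ[ℝ] ℝ := fun o =>
    o.elim (-mm) (fun j => innerₗ Y j.2.1 ∘ₗ pr j.1)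
  have hL : ∀ (p : ι → Y) (z : X) (μ : ℝ), L (p, z, μ) = ∑ i, p i - A z - μ • q := by
    intro p z μ; simp [L, pr, zz, mm]
  have hφ : ∀ (p : ι → Y) (z : X) (μ : ℝ),
      φ (p, z, μ) = inner ℝ v z + c * μ - ∑ i, a i (p i) := by
    intro p z μ; simp [φ, pr, zz, mm]
  have hψ : ∀ (p : ι → Y) (z : X) (μ : ℝ), (∀ o ∈ Finset.univ, ψ o (p, z, μ) ≤ 0) ↔
      0 ≤ μ ∧ ∀ i, p i ∈ polyCone (N i) := by
    intro p z μ
    simp only [Finset.mem_univ, forall_true_left, Option.forall, ψ, Option.elim, polyCone, pr, mm]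
    simp [Sigma.forall]
  obtain ⟨ζ, hζ⟩ := exists_dominating_functional L Finset.univ ψ φ (by
    rintro ⟨p, z, μ⟩ h1 h2
    rw [hψ] at h2
    rw [hL, sub_sub, sub_eq_zero] at h1
    have := h p h2.2 z μ h2.1 h1
    rw [hφ]; linarith)
  have hζ' : ∀ (p : ι → Y), (∀ i, p i ∈ polyCone (N i)) → ∀ (z : X) (μ : ℝ), 0 ≤ μ →
      inner ℝ v z + c * μ - ∑ i, a i (p i) ≤ ζ (∑ i, p i - A z - μ • q) := by
    intro p hp z μ hμ
    rw [← hL, ← hφ]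
    exact hζ _ ((hψ p z μ).2 ⟨hμ, hp⟩)
  have h0 : ∀ i, (0 : Y) ∈ polyCone (N i) := fun i n _ => by simp
  set ξ : Y := -((InnerProductSpace.toDual ℝ Y).symm (LinearMap.toContinuousLinearMap ζ))
  have hξ : ∀ y, inner ℝ ξ y = -ζ y := fun y => by
    simp [ξ]
  refine ⟨ξ, fun i p hp => ?_, fun z => ?_, ?_⟩
  · have := hζ' (Pi.single i p) (fun j => by
      by_cases hj : j = i
      · subst hj; simpa using hp
      · simpa [hj] using h0 j) 0 0 le_rfl
    rw [Finset.sum_eq_single i (fun j _ hj => by simp [hj]) (by simp),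
      Finset.sum_eq_single i (fun j _ hj => by simp [hj]) (by simp)] at this
    simp only [Pi.single_eq_same, inner_zero_right, mul_zero, map_zero, sub_zero, zero_smul,
      add_zero] at this
    rw [hξ]; linarith
  · have h1 := hζ' 0 h0 z 0 le_rfl
    have h2 := hζ' 0 h0 (-z) 0 le_rfl
    simp at h1 h2
    rw [hξ]; linarith
  · have h1 := hζ' 0 h0 0 1 zero_le_one
    simp at h1
    rw [hξ]; linarith

end Duality

section PolyCone

variable {Y : Type*} [NormedAddCommGroup Y] [InnerProductSpace ℝ Y]

/-! ### Polyhedral cones and their tangent cones -/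

lemma zero_mem_polyCone (N : Finset Y) : (0 : Y) ∈ polyCone N := fun n _ => by simp

lemma smul_mem_polyCone_iff {N : Finset Y} {t : ℝ} (ht : 0 < t) {u : Y} :
    t • u ∈ polyCone N ↔ u ∈ polyCone N := by
  refine forall₂_congr fun n _ => ?_
  rw [inner_smul_right]
  exact ⟨fun h => nonpos_of_mul_nonpos_right h ht,
    fun h => mul_nonpos_of_nonneg_of_nonpos ht.le h⟩

lemma isClosed_polyCone (N : Finset Y) : IsClosed (polyCone N) := by
  simp only [polyCone, Set.ofPred_forall]
  exact isClosed_iInter fun n => isClosed_iInter fun _ =>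
    isClosed_le (by fun_prop) continuous_const

open Classical in
/-- The normals active at `u`; they cut out the tangent cone of `polyCone N` at its point `u`. -/
noncomputable def activeNormals (N : Finset Y) (u : Y) : Finset Y :=
  N.filter fun n => inner ℝ n u = 0

lemma mem_polyCone_activeNormals {N : Finset Y} {u p : Y} :
    p ∈ polyCone (activeNormals N u) ↔ ∀ n ∈ N, inner ℝ n u = 0 → inner ℝ n p ≤ 0 := by
  simp [polyCone, activeNormals]

lemma eventually_add_smul_mem_polyCone {N : Finset Y} {u p : Y} (hu : u ∈ polyCone N)
    (hp : p ∈ polyCone (activeNormals N u)) : ∀ᶠ s in 𝓝[>] (0 : ℝ), u + s • p ∈ polyCone N := by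
  rw [mem_polyCone_activeNormals] at hp
  refine (Filter.eventually_all_finset N).2 fun n hn => ?_
  rcases (hu n hn).lt_or_eq with hlt | heq
  · have h1 : Tendsto (fun s : ℝ => inner ℝ n (u + s • p)) (𝓝 0) (𝓝 (inner ℝ n u)) :=
      (by fun_prop : Continuous fun s : ℝ => inner ℝ n (u + s • p)).tendsto' _ _ (by simp)
    filter_upwards [nhdsWithin_le_nhds (h1.eventually (Iio_mem_nhds hlt))] with s hs using hs.le
  · filter_upwards [self_mem_nhdsWithin] with s hs
    rw [inner_add_right, heq, zero_add, inner_smul_right]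
    exact mul_nonpos_of_nonneg_of_nonpos (le_of_lt hs) (hp n hn heq)

/-- Tangent directions, obtained as limits along a filter, of a polyhedral cone. -/
lemma mem_polyCone_of_frequently {ι : Type*} {l : Filter ι} {N : Finset Y} {u p : Y} {s : ι → ℝ}
    {P : ι → Y} (hs : Tendsto s l (𝓝[>] 0)) (hP : Tendsto P l (𝓝 p))
    (h : ∃ᶠ i in l, u + s i • P i ∈ polyCone N) :
    u ∈ polyCone N ∧ p ∈ polyCone (activeNormals N u) := by
  have hs0 : Tendsto s l (𝓝 0) := hs.mono_right nhdsWithin_le_nhds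
  have hlim : Tendsto (fun i => u + s i • P i) l (𝓝 u) := by
    simpa using tendsto_const_nhds.add (hs0.smul hP)
  refine ⟨(isClosed_polyCone N).mem_of_frequently_of_tendsto h hlim, ?_⟩
  rw [mem_polyCone_activeNormals]
  intro n hn hnu
  have hcl : IsClosed {v : Y | inner ℝ n v ≤ 0} := isClosed_le (by fun_prop) continuous_const
  refine hcl.mem_of_frequently_of_tendsto ?_ hP
  refine (h.and_eventually (hs.eventually self_mem_nhdsWithin)).mono fun i hi => ?_
  have h1 := hi.1 n hn
  rw [inner_add_right, hnu, zero_add, inner_smul_right] at h1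
  exact nonpos_of_mul_nonpos_right h1 hi.2

lemma IsPolyhedral.isClosed {C : Set Y} (hC : IsPolyhedral C) : IsClosed C := by
  obtain ⟨k, a, b, rfl⟩ := hC
  simp only [Set.ofPred_forall]
  exact isClosed_iInter fun i => isClosed_le (by fun_prop) continuous_const

/-- Near each of its points a polyhedral set coincides with a translated polyhedral cone. -/
lemma IsPolyhedral.exists_polyCone {C : Set Y} (hC : IsPolyhedral C) {y : Y} (hy : y ∈ C) :
    ∃ N : Finset Y, ∀ᶠ u in 𝓝 (0 : Y), y + u ∈ C ↔ u ∈ polyCone N := by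
  classical
  obtain ⟨k, a, b, rfl⟩ := hC
  refine ⟨(Finset.univ.filter fun i => inner ℝ (a i) y = b i).image a, ?_⟩
  have h1 : ∀ i, ∀ᶠ u in 𝓝 (0 : Y), inner ℝ (a i) y ≠ b i → inner ℝ (a i) (y + u) ≤ b i := by
    intro i
    by_cases hi : inner ℝ (a i) y = b i
    · simp [hi]
    · have h2 : Tendsto (fun u : Y => inner ℝ (a i) (y + u)) (𝓝 0) (𝓝 (inner ℝ (a i) y)) :=
        (by fun_prop : Continuous fun u : Y => inner ℝ (a i) (y + u)).tendsto' _ _ (by simp)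
      filter_upwards [h2.eventually (Iio_mem_nhds (lt_of_le_of_ne (hy i) hi))] with u hu _
        using le_of_lt hu
  filter_upwards [eventually_all.2 h1] with u hu
  simp only [Set.mem_ofPred_eq, polyCone, Finset.mem_image, Finset.mem_filter, Finset.mem_univ,
    true_and, forall_exists_index, and_imp]
  constructor
  · rintro h n i hi rfl
    have := h i
    rw [inner_add_right, hi] at this
    linarith
  · intro h i
    by_cases hi : inner ℝ (a i) y = b i
    · rw [inner_add_right, hi]
      linarith [h _ i hi rfl]
    · exact hu i hi

end PolyCone

lemma exists_frequently_of_frequently_exists {α ι : Type*} [Finite ι] {l : Filter α}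
    {p : ι → α → Prop} (h : ∃ᶠ x in l, ∃ i, p i x) : ∃ i, ∃ᶠ x in l, p i x := by
  by_contra hne
  simp only [not_exists, not_frequently] at hne
  exact h ((eventually_all.2 hne).mono fun x hx ⟨i, hi⟩ => hx i hi)

lemma liminf_le_liminf_comp {α β : Type*} {l : Filter α} {l' : Filter β} {π : β → α}
    (hπ : Tendsto π l' l) (φ : α → EReal) : liminf φ l ≤ liminf (φ ∘ π) l' :=
  liminf_le_liminf_of_le hπ

lemma coe_le_quot_iff' (a : EReal) (r c : ℝ) {d : ℝ} (hd : 0 < d) :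
    (c : EReal) ≤ (a - r) / d ↔ ((r + c * d : ℝ) : EReal) ≤ a := by
  simpa using coe_le_quot_iff a r 0 c hd

lemma HasTaylorTwo.hasFDerivAt {E G : Type*} [NormedAddCommGroup E] [InnerProductSpace ℝ E]
    [NormedAddCommGroup G] [InnerProductSpace ℝ G] {g : E → G} {x : E} {A : E →L[ℝ] G}
    {D : E →L[ℝ] E →L[ℝ] G} (hg : HasTaylorTwo g x A D) : HasFDerivAt g A x := by
  rw [hasFDerivAt_iff_isLittleO_nhds_zero]
  have h1 : (fun h : E => ‖h‖ ^ 2) =o[𝓝 0] fun h => h := by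
    refine Asymptotics.IsLittleO.of_norm_right ?_
    have := Asymptotics.isLittleO_norm_pow_id (E' := E) one_lt_two
    exact this.norm_right
  have h2 : (fun h : E => (1 / 2 : ℝ) • D h h) =O[𝓝 0] fun h => ‖h‖ ^ 2 := by
    refine .of_bound (1 / 2 * ‖D‖) (.of_forall fun h => ?_)
    rw [norm_smul, norm_pow, norm_norm]
    have := D.le_opNorm₂ h h
    norm_num
    nlinarith
  refine ((Asymptotics.IsLittleO.trans hg h1).add (h2.trans_isLittleO h1)).congr_left fun h => ?_
  abel

section Model

variable {Y : Type*} [NormedAddCommGroup Y] [InnerProductSpace ℝ Y]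

/-! ### The local conic model of a piecewise twice differentiable function -/

/-- A local description of `ϑ` near a point `y` of its domain: the domain is `y` plus a finite union
of polyhedral cones `polyCone (N i)`, on each of which `ϑ` agrees with a real function `g i` that has
a second-order expansion at `y`, with derivative `a i` and second derivative `D i`. -/
structure ConicModel (ϑ : Y → EReal) (y : Y) (ι : Type) where
  /-- the normals of the cones -/
  N : ι → Finset Y
  /-- the smooth pieces -/
  g : ι → Y → ℝ
  /-- their derivatives at `y` -/
  a : ι → Y →L[ℝ] ℝ
  /-- their second derivatives at `y` -/
  D : ι → Y →L[ℝ] Y →L[ℝ] ℝ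
  taylor : ∀ i, HasTaylorTwo (g i) y (a i) (D i)
  near : ∀ᶠ u in 𝓝 (0 : Y), ∀ i, u ∈ polyCone (N i) → ϑ (y + u) = (g i (y + u) : EReal)
  dom_near : ∀ᶠ u in 𝓝 (0 : Y), ϑ (y + u) < ⊤ → ∃ i, u ∈ polyCone (N i)

lemma IsPWTD.exists_conicModel {ϑ : Y → EReal} (h : IsPWTD ϑ) {y : Y} (hy : ϑ y < ⊤) :
    ∃ (ι : Type) (_ : Fintype ι) (_ : Nonempty ι), Nonempty (ConicModel ϑ y ι) := by
  classical
  obtain ⟨-, s, C, hC, hdom, hg⟩ := h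
  choose g U hU hCU hgU hgC using hg
  have hyC : ∃ i, y ∈ C i := by
    have : y ∈ dom ϑ := hy
    rw [hdom] at this
    simpa using this
  choose N hN using fun i : {i : Fin s // y ∈ C i} => (hC i).exists_polyCone i.2
  refine ⟨{i : Fin s // y ∈ C i}, inferInstance, ⟨⟨_, hyC.choose_spec⟩⟩, ⟨{
    N := N
    g := fun i => g i
    a := fun i => fderiv ℝ (g i) y
    D := fun i => fderiv ℝ (fderiv ℝ (g i)) y
    taylor := fun i => (hgU i).hasTaylorTwo (hU i) (hCU i i.2)
    near := ?_
    dom_near := ?_ }⟩⟩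
  · filter_upwards [eventually_all.2 hN] with u hu i hi using hgC i _ ((hu i).2 hi)
  · have hshift : Tendsto (fun u : Y => y + u) (𝓝 0) (𝓝 y) :=
      (continuous_const.add continuous_id).tendsto' _ _ (by simp)
    have hout : ∀ i, ∀ᶠ u in 𝓝 (0 : Y), y ∉ C i → y + u ∉ C i := fun i => by
      by_cases hi : y ∈ C i
      · simp [hi]
      · filter_upwards [hshift.eventually ((hC i).isClosed.isOpen_compl.mem_nhds hi)] with u hu _
          using hu
    filter_upwards [eventually_all.2 hN, eventually_all.2 hout] with u hu hu' hlt
    have : y + u ∈ dom ϑ := hlt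
    rw [hdom, Set.mem_iUnion] at this
    obtain ⟨i, hi⟩ := this
    have hyi : y ∈ C i := by
      by_contra hne
      exact hu' i hne hi
    exact ⟨⟨i, hyi⟩, (hu ⟨i, hyi⟩).1 hi⟩

lemma IsPWTD.isClosed_epiL2 {ϑ : Y → EReal} (h : IsPWTD ϑ) : IsClosed (epiL2 ϑ) := by
  obtain ⟨-, s, C, hC, hdom, hg⟩ := h
  choose g U hU hCU hgU hgC using hg
  have hset : epiL2 ϑ = ⋃ i, {p : WithLp 2 (Y × ℝ) | (WithLp.ofLp p).1 ∈ C i ∧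
      g i (WithLp.ofLp p).1 ≤ (WithLp.ofLp p).2} := by
    ext p
    simp only [epi, Set.mem_ofPred_eq, Set.mem_iUnion]
    constructor
    · intro hp
      have : (WithLp.ofLp p).1 ∈ dom ϑ := lt_of_le_of_lt hp (EReal.coe_lt_top _)
      rw [hdom, Set.mem_iUnion] at this
      obtain ⟨i, hi⟩ := this
      refine ⟨i, hi, ?_⟩
      rwa [hgC i _ hi, EReal.coe_le_coe_iff] at hp
    · rintro ⟨i, hi, hp⟩
      rwa [hgC i _ hi, EReal.coe_le_coe_iff]
  rw [hset]
  refine isClosed_iUnion_of_finite fun i => ?_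
  have hc := WithLp.prod_continuous_ofLp 2 Y ℝ
  have hcl : IsClosed {p : WithLp 2 (Y × ℝ) | (WithLp.ofLp p).1 ∈ C i} :=
    (hC i).isClosed.preimage (continuous_fst.comp hc)
  refine hcl.isClosed_le (f := fun p => g i (WithLp.ofLp p).1) (g := fun p => (WithLp.ofLp p).2)
    ?_ (continuous_snd.comp hc).continuousOn
  exact ((hgU i).1.continuousOn.mono (hCU i)).comp (continuous_fst.comp hc).continuousOn
    fun p hp => hp

namespace ConicModel

variable {ϑ : Y → EReal} {y : Y} {ι : Type} (M : ConicModel ϑ y ι)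

/-- The tangent cone at `u` of the `i`-th cone of the model. -/
def tangent (u : Y) (i : ι) : Set Y := polyCone (activeNormals (M.N i) u)

lemma value_eq (i : ι) : ϑ y = (M.g i y : EReal) := by
  simpa using M.near.self_of_nhds i (zero_mem_polyCone _)

lemma eventually_value {α : Type*} {l : Filter α} {P : α → Y} (hP : Tendsto P l (𝓝 y)) :
    ∀ᶠ s in l, ϑ (P s) ≠ ⊤ → ∃ i, P s - y ∈ polyCone (M.N i) ∧ ϑ (P s) = (M.g i (P s) : EReal) := by
  have h0 : Tendsto (fun s => P s - y) l (𝓝 0) := by simpa using hP.sub_const y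
  filter_upwards [h0.eventually M.near, h0.eventually M.dom_near] with s h1 h2 hs
  rw [add_sub_cancel] at h1 h2
  obtain ⟨i, hi⟩ := h2 (lt_top_iff_ne_top.2 hs)
  exact ⟨i, hi, h1 i hi⟩

lemma eventually_eq {α : Type*} {l : Filter α} {P : α → Y} (hP : Tendsto P l (𝓝 y)) (i : ι) :
    ∀ᶠ s in l, P s - y ∈ polyCone (M.N i) → ϑ (P s) = (M.g i (P s) : EReal) := by
  have h0 : Tendsto (fun s => P s - y) l (𝓝 0) := by simpa using hP.sub_const y
  filter_upwards [h0.eventually M.near] with s h1 hs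
  simpa using h1 i hs

lemma tendsto_ray (u : Y) : Tendsto (fun t : ℝ => y + t • u) (𝓝[>] 0) (𝓝 y) := by
  have h := tendsto_id_nhdsGT_zero.smul (tendsto_const_nhds (x := u))
  simpa using tendsto_const_nhds.add h

lemma eventually_ray {u : Y} {i : ι} (hu : u ∈ polyCone (M.N i)) :
    ∀ᶠ t in 𝓝[>] (0 : ℝ), ϑ (y + t • u) = (M.g i (y + t • u) : EReal) := by
  filter_upwards [M.eventually_eq (tendsto_ray u) i, self_mem_nhdsWithin] with t h1 ht
  refine h1 ?_
  rw [add_sub_cancel_left]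
  exact (smul_mem_polyCone_iff ht).2 hu

lemma tendsto_slope (i : ι) (u : Y) :
    Tendsto (fun t : ℝ => t⁻¹ • (M.g i (y + t • u) - M.g i y)) (𝓝[>] 0) (𝓝 (M.a i u)) :=
  ((M.taylor i).hasSemideriv u).comp (tendsto_id.prodMk tendsto_const_nhds)

lemma a_eq {u : Y} {i j : ι} (hi : u ∈ polyCone (M.N i)) (hj : u ∈ polyCone (M.N j)) :
    M.a i u = M.a j u := by
  refine tendsto_nhds_unique_of_eventuallyEq (M.tendsto_slope i u) (M.tendsto_slope j u) ?_
  filter_upwards [M.eventually_ray hi, M.eventually_ray hj] with t h1 h2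
  have h3 := EReal.coe_injective (h1.symm.trans h2)
  have h4 := EReal.coe_injective ((M.value_eq i).symm.trans (M.value_eq j))
  rw [h3, h4]

lemma D_eq {u : Y} {i j : ι} (hi : u ∈ polyCone (M.N i)) (hj : u ∈ polyCone (M.N j)) :
    M.D i u u = M.D j u u := by
  have h := fun i => ((M.taylor i).tendsto_quot u).comp
    (tendsto_id.prodMk tendsto_const_nhds : Tendsto (fun t : ℝ => (t, u)) (𝓝[>] 0) _)
  refine tendsto_nhds_unique_of_eventuallyEq (h i) (h j) ?_
  filter_upwards [M.eventually_ray hi, M.eventually_ray hj] with t h1 h2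
  have h3 := EReal.coe_injective (h1.symm.trans h2)
  have h4 := EReal.coe_injective ((M.value_eq i).symm.trans (M.value_eq j))
  simp only [Function.comp_apply, id_eq]
  rw [h3, h4, M.a_eq hi hj]

/-! ### First-order variational objects in terms of the model -/

lemma le_subderiv [Finite ι] [Nonempty ι] {u : Y} {c : ℝ}
    (h : ∀ i, u ∈ polyCone (M.N i) → c < M.a i u) : (c : EReal) ≤ subderiv ϑ y u := by
  refine le_liminf_of_le (by isBoundedDefault) ?_
  have hP : Tendsto (fun p : ℝ × Y => y + p.1 • p.2) (𝓝[>] (0 : ℝ) ×ˢ 𝓝 u) (𝓝 y) := by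
    have h1 : Tendsto (fun p : ℝ × Y => p.1) (𝓝[>] (0 : ℝ) ×ˢ 𝓝 u) (𝓝 0) :=
      tendsto_fst.mono_right nhdsWithin_le_nhds
    simpa using tendsto_const_nhds.add (h1.smul tendsto_snd)
  have hi : ∀ i, ∀ᶠ p : ℝ × Y in 𝓝[>] (0 : ℝ) ×ˢ 𝓝 u, p.2 ∈ polyCone (M.N i) →
      c ≤ p.1⁻¹ • (M.g i (y + p.1 • p.2) - M.g i y) := by
    intro i
    by_cases hui : u ∈ polyCone (M.N i)
    · filter_upwards [((M.taylor i).hasSemideriv u).eventually (Ioi_mem_nhds (h i hui))]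
        with p hp _ using le_of_lt hp
    · have := (tendsto_snd : Tendsto _ (𝓝[>] (0 : ℝ) ×ˢ 𝓝 u) _).eventually
        ((isClosed_polyCone (M.N i)).isOpen_compl.mem_nhds hui)
      filter_upwards [this] with p hp h' using absurd h' hp
  have hpos : ∀ᶠ p : ℝ × Y in 𝓝[>] (0 : ℝ) ×ˢ 𝓝 u, 0 < p.1 :=
    tendsto_fst.eventually self_mem_nhdsWithin
  filter_upwards [M.eventually_value hP, eventually_all.2 hi, hpos] with p h1 h2 hp
  obtain ⟨i₀⟩ := ‹Nonempty ι›
  rw [M.value_eq i₀, coe_le_quot_iff' _ _ _ hp]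
  by_cases htop : ϑ (y + p.1 • p.2) = ⊤
  · rw [htop]; exact le_top
  · obtain ⟨i, hmem, heq⟩ := h1 htop
    rw [add_sub_cancel_left, smul_mem_polyCone_iff hp] at hmem
    have h3 := h2 i hmem
    rw [smul_eq_mul, inv_mul_eq_div, le_div_iff₀ hp] at h3
    have h4 := EReal.coe_injective ((M.value_eq i₀).symm.trans (M.value_eq i))
    rw [heq, EReal.coe_le_coe_iff, h4]
    linarith

lemma subderiv_eq [Finite ι] [Nonempty ι] {u : Y} {i : ι} (hu : u ∈ polyCone (M.N i)) :
    subderiv ϑ y u = (M.a i u : EReal) := by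
  refine le_antisymm ?_ ?_
  · refine (liminf_le_liminf_comp (tendsto_id.prodMk tendsto_const_nhds :
      Tendsto (fun t : ℝ => (t, u)) (𝓝[>] 0) _) _).trans_eq ?_
    rw [← liminf_coe_eq (M.tendsto_slope i u)]
    refine liminf_congr ?_
    filter_upwards [M.eventually_ray hu] with t ht
    simp only [Function.comp_apply, id_eq]
    rw [ht, M.value_eq i, smul_eq_mul, inv_mul_eq_div]
    norm_cast
  · refine EReal.ge_of_forall_gt_iff_ge.1 fun c hc => ?_
    exact M.le_subderiv fun j hj => by
      rw [M.a_eq hj hu]; exact_mod_cast hc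

/-- Every `ξ` dominated by the first-order model is a subgradient. -/
lemma mem_subdiff_of_le [Finite ι] [Nonempty ι] {ξ : Y}
    (h : ∀ i, ∀ u ∈ polyCone (M.N i), inner ℝ ξ u ≤ M.a i u) : ξ ∈ subdiff ϑ y := by
  refine regSubdiff_subset_subdiff ?_
  obtain ⟨i₀⟩ := ‹Nonempty ι›
  rw [mem_regSubdiff_iff]
  refine ⟨by simp [M.value_eq i₀], by simp [M.value_eq i₀], fun ε hε => ?_⟩
  have hi : ∀ i, ∀ᶠ x' in 𝓝 y, ‖M.g i x' - M.g i y - M.a i (x' - y)‖ ≤ ε * ‖x' - y‖ := fun i =>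
    (M.taylor i).hasFDerivAt.isLittleO.bound hε
  filter_upwards [M.eventually_value tendsto_id, eventually_all.2 hi] with x' h1 h2
  by_cases htop : ϑ x' = ⊤
  · rw [htop]; exact le_top
  · obtain ⟨i, hmem, heq⟩ := h1 htop
    simp only [id_eq] at hmem heq
    rw [heq, EReal.coe_le_coe_iff, M.value_eq i, EReal.toReal_coe]
    have h3 := neg_le_of_abs_le (h2 i)
    have h4 := h i _ hmem
    linarith

/-- The tangent directions `(u, a i u)` of the epigraph are in the polar of the regular normals. -/
lemma inner_nonpos_of_mem_regNormalCone_epi {n : WithLp 2 (Y × ℝ)}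
    (hn : n ∈ regNormalCone (epiL2 ϑ) (WithLp.toLp 2 (y, (ϑ y).toReal))) {i : ι} {u : Y}
    (hu : u ∈ polyCone (M.N i)) : inner ℝ n (WithLp.toLp 2 (u, M.a i u)) ≤ 0 := by
  refine CompositeVA.inner_nonpos_of_mem_regNormalCone hn
    (P := fun t => WithLp.toLp 2 (u, t⁻¹ • (M.g i (y + t • u) - M.g i y))) ?_ ?_
  · filter_upwards [M.eventually_ray hu, self_mem_nhdsWithin] with t h1 ht
    have ht : 0 < t := ht
    simp only [epi, Set.mem_ofPred_eq, WithLp.ofLp_add, WithLp.ofLp_smul, Prod.fst_add,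
      Prod.snd_add, Prod.smul_fst, Prod.smul_snd]
    rw [h1, M.value_eq i, EReal.toReal_coe, EReal.coe_le_coe_iff, smul_inv_smul₀ ht.ne']
    simp
  · exact ((WithLp.prod_continuous_toLp 2 Y ℝ).tendsto _).comp
      (tendsto_const_nhds.prodMk_nhds (M.tendsto_slope i u))

/-- Under regularity, the polar of the regular normals to the epigraph is no larger than the
first-order model of the epigraph. -/
lemma exists_of_polar [FiniteDimensional ℝ Y] [Finite ι] [Nonempty ι] (hreg : RegularAt ϑ y)
    (hcl : IsClosed (epiL2 ϑ)) {u : Y} {β : ℝ}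
    (h : ∀ n ∈ regNormalCone (epiL2 ϑ) (WithLp.toLp 2 (y, (ϑ y).toReal)),
      inner ℝ n (WithLp.toLp 2 (u, β)) ≤ 0) :
    ∃ i, u ∈ polyCone (M.N i) ∧ M.a i u ≤ β := by
  by_contra hne
  obtain ⟨i₀⟩ := ‹Nonempty ι›
  set P₀ : WithLp 2 (Y × ℝ) := WithLp.toLp 2 (y, (ϑ y).toReal) with hP₀
  set p : WithLp 2 (Y × ℝ) := WithLp.toLp 2 (u, β) with hp
  have hP₀mem : P₀ ∈ epiL2 ϑ := by simp [hP₀, epi, M.value_eq i₀]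
  have hsep : ∃ k : ℕ, ∀ t : ℝ, 0 < t → t < 1 / ((k : ℝ) + 1) → ∀ s ∈ epiL2 ϑ,
      1 / ((k : ℝ) + 1) * t ≤ ‖P₀ + t • p - s‖ := by
    by_contra hno
    push Not at hno
    choose t ht0 ht1 s hs hst using hno
    have htlim : Tendsto t atTop (𝓝[>] 0) := by
      refine tendsto_nhdsWithin_iff.2 ⟨?_, .of_forall ht0⟩
      exact squeeze_zero (fun k => (ht0 k).le) (fun k => (ht1 k).le)
        tendsto_one_div_add_atTop_nhds_zero_nat
    set e : ℕ → WithLp 2 (Y × ℝ) := fun k => (t k)⁻¹ • (s k - P₀) with he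
    have hse : ∀ k, s k = P₀ + t k • e k := fun k => by
      rw [he]; simp only; rw [smul_inv_smul₀ (ht0 k).ne']; abel
    have helim : Tendsto e atTop (𝓝 p) := by
      rw [tendsto_iff_norm_sub_tendsto_zero]
      refine squeeze_zero (fun _ => norm_nonneg _) (fun k => ?_)
        tendsto_one_div_add_atTop_nhds_zero_nat
      have h1 := hst k
      rw [hse, add_sub_add_left_eq_sub, ← smul_sub, norm_smul, Real.norm_of_nonneg (ht0 k).le,
        mul_comm, norm_sub_rev] at h1
      exact (lt_of_mul_lt_mul_right h1 (ht0 k).le).le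
    have he1 : Tendsto (fun k => (WithLp.ofLp (e k)).1) atTop (𝓝 u) :=
      ((continuous_fst.comp (WithLp.prod_continuous_ofLp 2 Y ℝ)).tendsto p).comp helim
    have he2 : Tendsto (fun k => (WithLp.ofLp (e k)).2) atTop (𝓝 β) :=
      ((continuous_snd.comp (WithLp.prod_continuous_ofLp 2 Y ℝ)).tendsto p).comp helim
    have hs' : ∀ k, ϑ (y + t k • (WithLp.ofLp (e k)).1) ≤
        (((ϑ y).toReal + t k * (WithLp.ofLp (e k)).2 : ℝ) : EReal) := fun k => by
      have := hs k
      rw [hse k] at this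
      exact this
    have hcurve : Tendsto (fun k => y + t k • (WithLp.ofLp (e k)).1) atTop (𝓝 y) := by
      simpa using tendsto_const_nhds.add ((htlim.mono_right nhdsWithin_le_nhds).smul he1)
    have hfr : ∃ᶠ k in atTop, ∃ i, (WithLp.ofLp (e k)).1 ∈ polyCone (M.N i) ∧
        (t k)⁻¹ • (M.g i (y + t k • (WithLp.ofLp (e k)).1) - M.g i y) ≤
          (WithLp.ofLp (e k)).2 := by
      refine Eventually.frequently ?_
      filter_upwards [M.eventually_value hcurve] with k hk
      obtain ⟨i, hi, heq⟩ := hk (ne_top_of_le_ne_top (EReal.coe_ne_top _) (hs' k))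
      rw [add_sub_cancel_left, smul_mem_polyCone_iff (ht0 k)] at hi
      refine ⟨i, hi, ?_⟩
      have h1 := hs' k
      rw [heq, EReal.coe_le_coe_iff, M.value_eq i, EReal.toReal_coe] at h1
      rw [smul_eq_mul, inv_mul_eq_div, div_le_iff₀ (ht0 k)]
      linarith
    obtain ⟨i, hi⟩ := exists_frequently_of_frequently_exists hfr
    refine hne ⟨i, (isClosed_polyCone _).mem_of_frequently_of_tendsto
      (hi.mono fun k hk => hk.1) he1, ?_⟩
    have h2 := ((M.taylor i).hasSemideriv u).comp (htlim.prodMk he1)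
    exact (isClosed_le_prod (α := ℝ)).mem_of_frequently_of_tendsto
      (hi.mono fun k hk => hk.2) (h2.prodMk_nhds he2)
  obtain ⟨k, hk⟩ := hsep
  obtain ⟨n, hn, hpos⟩ := exists_mem_normalCone_inner_pos hcl hP₀mem
    (by positivity : (0 : ℝ) < 1 / ((k : ℝ) + 1)) (by positivity) hk
  have hn' : n ∈ regNormalCone (epiL2 ϑ) P₀ := by
    have : regNormalCone (epiL2 ϑ) P₀ = normalCone (epiL2 ϑ) P₀ := hreg
    rwa [this]
  exact absurd (h n hn') (not_le.2 hpos)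

/-- Under regularity the first-order model is subadditive. -/
lemma exists_add [FiniteDimensional ℝ Y] [Finite ι] [Nonempty ι] (hreg : RegularAt ϑ y)
    (hcl : IsClosed (epiL2 ϑ)) {u u' : Y} {i j : ι} (hu : u ∈ polyCone (M.N i))
    (hu' : u' ∈ polyCone (M.N j)) :
    ∃ k, u + u' ∈ polyCone (M.N k) ∧ M.a k (u + u') ≤ M.a i u + M.a j u' := by
  refine M.exists_of_polar hreg hcl fun n hn => ?_
  have h1 := M.inner_nonpos_of_mem_regNormalCone_epi hn hu
  have h2 := M.inner_nonpos_of_mem_regNormalCone_epi hn hu'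
  have h3 : (WithLp.toLp 2 (u + u', M.a i u + M.a j u') : WithLp 2 (Y × ℝ)) =
      WithLp.toLp 2 (u, M.a i u) + WithLp.toLp 2 (u', M.a j u') := rfl
  rw [h3, inner_add_right]
  linarith

/-- Under regularity every subgradient is dominated by the first-order model. -/
lemma le_of_mem_subdiff (hreg : RegularAt ϑ y) {ξ : Y} (hξ : ξ ∈ subdiff ϑ y) {i : ι} {u : Y}
    (hu : u ∈ polyCone (M.N i)) : inner ℝ ξ u ≤ M.a i u := by
  have h1 := subdiff_to_normalCone hξ
  have h2 : regNormalCone (epiL2 ϑ) (WithLp.toLp 2 (y, (ϑ y).toReal)) =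
    normalCone (epiL2 ϑ) (WithLp.toLp 2 (y, (ϑ y).toReal)) := hreg
  rw [← h2] at h1
  have h3 := M.inner_nonpos_of_mem_regNormalCone_epi h1 hu
  rw [WithLp.prod_inner_apply] at h3
  simp at h3
  linarith

/-! ### Directional version of the first-order model -/

/-- Under regularity the first-order model of the directional derivative is subadditive. -/
lemma exists_add_tangent [FiniteDimensional ℝ Y] [Finite ι] [Nonempty ι] (hreg : RegularAt ϑ y)
    (hcl : IsClosed (epiL2 ϑ)) {u p p' : Y} {i j : ι} (hi : u ∈ polyCone (M.N i))
    (hj : u ∈ polyCone (M.N j)) (hp : p ∈ M.tangent u i) (hp' : p' ∈ M.tangent u j) :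
    ∃ k, u ∈ polyCone (M.N k) ∧ p + p' ∈ M.tangent u k ∧
      M.a k (p + p') ≤ M.a i p + M.a j p' := by
  have hfr : ∃ᶠ s in 𝓝[>] (0 : ℝ), ∃ k, u + (s / 2) • (p + p') ∈ polyCone (M.N k) ∧
      2 * M.a k u + s * M.a k (p + p') ≤ 2 * M.a i u + s * (M.a i p + M.a j p') := by
    refine Eventually.frequently ?_
    filter_upwards [eventually_add_smul_mem_polyCone hi hp,
      eventually_add_smul_mem_polyCone hj hp'] with s h1 h2
    obtain ⟨k, hk, hle⟩ := M.exists_add hreg hcl h1 h2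
    have h3 : u + s • p + (u + s • p') = (2 : ℝ) • (u + (s / 2) • (p + p')) := by module
    rw [h3, smul_mem_polyCone_iff two_pos] at hk
    refine ⟨k, hk, ?_⟩
    rw [h3] at hle
    simp only [map_smul, map_add, smul_eq_mul, ← M.a_eq hi hj] at hle ⊢
    linarith
  obtain ⟨k, hk⟩ := exists_frequently_of_frequently_exists hfr
  obtain ⟨h1, h2⟩ := mem_polyCone_of_frequently tendsto_half_nhdsGT_zero tendsto_const_nhds
    (hk.mono fun s hs => hs.1)
  refine ⟨k, h1, h2, ?_⟩
  obtain ⟨s, hs, hs0⟩ := (hk.and_eventually self_mem_nhdsWithin).exists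
  have hle := hs.2
  rw [M.a_eq h1 hi] at hle
  exact le_of_mul_le_mul_left (by linarith) hs0

/-- If `ξ` is dominated by the directional model at `u`, then it is a subgradient active at `u`. -/
lemma mem_activeSubgrads_of_le [FiniteDimensional ℝ Y] [Finite ι] [Nonempty ι]
    (hreg : RegularAt ϑ y) (hcl : IsClosed (epiL2 ϑ)) {u ξ : Y} {i₀ : ι}
    (hu : u ∈ polyCone (M.N i₀))
    (h : ∀ i, u ∈ polyCone (M.N i) → ∀ p ∈ M.tangent u i, inner ℝ ξ p ≤ M.a i p) :
    ξ ∈ activeSubgrads ϑ y u := by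
  have hact : inner ℝ ξ u = M.a i₀ u := by
    -- both `u` and `-u` are tangent to the cone at `u`
    have h1 := h i₀ hu u (mem_polyCone_activeNormals.2 fun n _ h0 => h0.le)
    have h2 := h i₀ hu (-u) (mem_polyCone_activeNormals.2 fun n _ h0 => by simp [h0])
    rw [inner_neg_right, map_neg] at h2
    linarith
  refine ⟨M.mem_subdiff_of_le fun j u' hu' => ?_, by rw [M.subderiv_eq hu, hact]⟩
  -- move from `u` in the direction `u'` and use subadditivity
  have hfr : ∃ᶠ s in 𝓝[>] (0 : ℝ), ∃ k, u + s • u' ∈ polyCone (M.N k) ∧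
      M.a k u + s * M.a k u' ≤ M.a i₀ u + s * M.a j u' := by
    refine Eventually.frequently ?_
    filter_upwards [self_mem_nhdsWithin] with s hs
    obtain ⟨k, hk, hle⟩ := M.exists_add hreg hcl hu ((smul_mem_polyCone_iff hs).2 hu')
    refine ⟨k, hk, ?_⟩
    simpa using hle
  obtain ⟨k, hk⟩ := exists_frequently_of_frequently_exists hfr
  obtain ⟨h1, h2⟩ := mem_polyCone_of_frequently (tendsto_nhdsWithin_iff.2
    ⟨tendsto_id_nhdsGT_zero, self_mem_nhdsWithin⟩) tendsto_const_nhds (hk.mono fun s hs => hs.1)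
  obtain ⟨s, hs, hs0⟩ := (hk.and_eventually self_mem_nhdsWithin).exists
  have hle := hs.2
  rw [M.a_eq h1 hu, add_le_add_iff_left] at hle
  exact (h k h1 u' h2).trans (le_of_mul_le_mul_left hle hs0)

lemma inner_le_of_mem_activeSubgrads [Finite ι] [Nonempty ι] (hreg : RegularAt ϑ y) {u ξ p : Y}
    {i : ι} (hu : u ∈ polyCone (M.N i)) (hp : p ∈ M.tangent u i) (hξ : ξ ∈ activeSubgrads ϑ y u) :
    inner ℝ ξ p ≤ M.a i p := by
  have h0 : M.a i u = inner ℝ ξ u := by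
    have := hξ.2
    rw [M.subderiv_eq hu] at this
    exact_mod_cast this
  obtain ⟨s, hs, hs0⟩ := ((eventually_add_smul_mem_polyCone hu hp).and
    self_mem_nhdsWithin).exists
  have h1 := M.le_of_mem_subdiff hreg hξ.1 hs
  rw [inner_add_right, inner_smul_right, map_add, map_smul, h0, add_le_add_iff_left,
    smul_eq_mul] at h1
  exact le_of_mul_le_mul_left h1 hs0

end ConicModel

end Model

section Recovery

variable {E : Type*} [NormedAddCommGroup E] [InnerProductSpace ℝ E]

/-! ### From parabolic recovery arcs to second-order variational properties -/

/-- The second subderivative of `h` in the critical direction `w` can be approximated from above to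
within any `b > L` along a parabolic arc `x + τ w + (τ² / 2) ζ τ`, defined for all small `τ`, on
which `h` has a second-order expansion. -/
def HasRecoveryArcs (h : E → EReal) (x v w : E) (L : ℝ) : Prop :=
  ∀ b : ℝ, L < b → ∃ (z : E) (ζ : ℝ → E) (ρ : ℝ) (r : ℝ → ℝ), ρ - inner ℝ v z < b ∧
    Tendsto ζ (𝓝[>] 0) (𝓝 z) ∧ Tendsto r (𝓝[>] 0) (𝓝 ρ) ∧
    ∀ᶠ τ in 𝓝[>] (0 : ℝ), h (x + τ • w + (τ ^ 2 / 2) • ζ τ) =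
      (((h x).toReal + τ * inner ℝ v w + τ ^ 2 / 2 * r τ : ℝ) : EReal)

variable {h : E → EReal} {x v w : E}

lemma coe_le_quot2For_iff {r τ c : ℝ} (hr : h x = r) (hτ : 0 < τ) (w' : E) :
    (c : EReal) ≤ quot2For h x v τ w' ↔
      ((r + τ * inner ℝ v w' + c * (τ ^ 2 / 2) : ℝ) : EReal) ≤ h (x + τ • w') := by
  rw [quot2For, hr, coe_le_quot_iff _ _ _ _ (by positivity)]

/-- If the subderivative exceeds the linear form `⟪v, ·⟫` at `w`, then the second subderivative for
`v` is infinite at `w`. -/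
lemma subderiv2For_eq_top {r : ℝ} (hr : h x = r)
    (hlt : ((inner ℝ v w : ℝ) : EReal) < subderiv h x w) : subderiv2For h x v w = ⊤ := by
  obtain ⟨c, hc1, hc2⟩ := EReal.lt_iff_exists_real_btwn.1 hlt
  have hc1 : inner ℝ v w < c := by exact_mod_cast hc1
  refine EReal.eq_top_iff_forall_lt _ |>.2 fun K => ?_
  have hK : ((K + 1 : ℝ) : EReal) ≤ subderiv2For h x v w := by
    refine le_liminf_of_le (by isBoundedDefault) ?_
    have h1 := eventually_lt_of_lt_liminf hc2
    have hpos : ∀ᶠ p : ℝ × E in 𝓝[>] (0 : ℝ) ×ˢ 𝓝 w, 0 < p.1 :=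
      tendsto_fst.eventually self_mem_nhdsWithin
    have hlim : Tendsto (fun p : ℝ × E => inner ℝ v p.2 + (K + 1) * (p.1 / 2))
        (𝓝[>] (0 : ℝ) ×ˢ 𝓝 w) (𝓝 (inner ℝ v w)) := by
      have h2 : Tendsto (fun p : ℝ × E => p.1) (𝓝[>] (0 : ℝ) ×ˢ 𝓝 w) (𝓝 0) :=
        tendsto_fst.mono_right nhdsWithin_le_nhds
      have h3 : Tendsto (fun p : ℝ × E => p.2) (𝓝[>] (0 : ℝ) ×ˢ 𝓝 w) (𝓝 w) := tendsto_snd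
      simpa using (tendsto_const_nhds.inner h3).add ((h2.div_const 2).const_mul (K + 1))
    filter_upwards [h1, hpos, hlim.eventually (Iio_mem_nhds hc1)] with p hp1 hp hp2
    have hp2 : inner ℝ v p.2 + (K + 1) * (p.1 / 2) < c := hp2
    have hp1 := hp1.le
    rw [hr, coe_le_quot_iff' _ _ _ hp] at hp1
    rw [coe_le_quot2For_iff hr hp]
    refine le_trans ?_ hp1
    rw [EReal.coe_le_coe_iff]
    nlinarith
  exact lt_of_lt_of_le (by exact_mod_cast lt_add_one K) hK

/-- In a critical direction, parabolic arcs are among the competitors for the second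
subderivative. -/
lemma subderiv2For_le_parSubderiv {r : ℝ} (hr : h x = r) (hw : w ∈ criticalCone h x v) (z : E) :
    subderiv2For h x v w ≤ parSubderiv h x w z - ((inner ℝ v z : ℝ) : EReal) := by
  have hw : subderiv h x w = ((inner ℝ v w : ℝ) : EReal) := hw
  refine EReal.ge_of_forall_gt_iff_ge.1 fun b hb => ?_
  obtain ⟨c, hbc, hc⟩ := EReal.lt_iff_exists_real_btwn.1 hb
  have hbc : b < c := by exact_mod_cast hbc
  rw [EReal.le_sub_iff_add_le (.inl (EReal.coe_ne_bot _)) (.inl (EReal.coe_ne_top _)),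
    ← EReal.coe_add]
  refine le_liminf_of_le (by isBoundedDefault) ?_
  have h1 := (tendsto_parabolic_direction w z).eventually (eventually_lt_of_lt_liminf hc)
  have hpos : ∀ᶠ p : ℝ × E in 𝓝[>] (0 : ℝ) ×ˢ 𝓝 z, 0 < p.1 :=
    tendsto_fst.eventually self_mem_nhdsWithin
  have h2 : Tendsto (fun p : ℝ × E => p.2) (𝓝[>] (0 : ℝ) ×ˢ 𝓝 z) (𝓝 z) := tendsto_snd
  have h3 := ((tendsto_const_nhds (x := v)).inner h2).eventually
    (Ioi_mem_nhds (sub_lt_self _ (sub_pos.2 hbc)))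
  filter_upwards [h1, hpos, h3] with p hp1 hp hp3
  have hp3 : inner ℝ v z - (c - b) < inner ℝ v p.2 := hp3
  have hp1 := hp1.le
  rw [coe_le_quot2For_iff hr hp, ← parabolic_arc_eq] at hp1
  rw [hw, hr, ← EReal.coe_mul, coe_le_quot_iff _ _ _ _ (by positivity)]
  refine le_trans ?_ hp1
  rw [EReal.coe_le_coe_iff, inner_add_right, inner_smul_right]
  nlinarith [sq_pos_of_pos hp]

lemma quot2For_recovery {r₀ τ r : ℝ} {ζ : E} (hr : h x = r₀) (hτ : 0 < τ)
    (heq : h (x + τ • w + (τ ^ 2 / 2) • ζ) =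
      (((h x).toReal + τ * inner ℝ v w + τ ^ 2 / 2 * r : ℝ) : EReal)) :
    quot2For h x v τ (w + (τ / 2) • ζ) = ((r - inner ℝ v ζ : ℝ) : EReal) := by
  rw [quot2For, ← parabolic_arc_eq, heq, hr, EReal.toReal_coe]
  rw [← EReal.coe_sub, ← EReal.coe_sub, ← EReal.coe_div, inner_add_right, inner_smul_right]
  congr 1
  field_simp
  ring

/-- Recovery arcs bound the infimum of the parabolic subderivatives. -/
lemma HasRecoveryArcs.iInf_parSubderiv_le {L : ℝ} (hrec : HasRecoveryArcs h x v w L) {r₀ : ℝ}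
    (hr : h x = r₀) (hw : w ∈ criticalCone h x v) :
    (⨅ z : E, (parSubderiv h x w z - ((inner ℝ v z : ℝ) : EReal))) ≤ L := by
  have hw : subderiv h x w = ((inner ℝ v w : ℝ) : EReal) := hw
  refine EReal.le_of_forall_lt_iff_le.1 fun b hb => ?_
  obtain ⟨z, ζ, ρ, r, hb', hζ, hρ, heq⟩ := hrec b (by exact_mod_cast hb)
  refine (iInf_le _ z).trans ?_
  have hpar : parSubderiv h x w z ≤ ρ := by
    refine (liminf_le_liminf_comp (tendsto_id.prodMk hζ) _).trans_eq ?_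
    rw [← liminf_coe_eq hρ]
    refine liminf_congr ?_
    filter_upwards [heq, self_mem_nhdsWithin] with τ h1 hτ
    have hτ : 0 < τ := hτ
    simp only [Function.comp_apply, id_eq]
    rw [h1, hw, hr, EReal.toReal_coe, ← EReal.coe_mul, ← EReal.coe_sub, ← EReal.coe_sub,
      ← EReal.coe_div]
    congr 1
    field_simp
    ring
  refine (EReal.sub_le_sub hpar le_rfl).trans ?_
  rw [← EReal.coe_sub, EReal.coe_le_coe_iff]
  exact hb'.le

/-- Epi-limits from below are automatic for the second subderivative. -/
lemma outerLim_epi_quot2For_subset :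
    outerLim (𝓝[>] (0 : ℝ)) (fun τ => epi (quot2For h x v τ)) ⊆ epi (subderiv2For h x v) := by
  rintro ⟨w, α⟩ hmem
  by_contra hlt
  have hlt : (α : EReal) < subderiv2For h x v w := not_le.1 hlt
  obtain ⟨c, hαc, hc⟩ := EReal.lt_iff_exists_real_btwn.1 hlt
  have hαc : α < c := by exact_mod_cast hαc
  obtain ⟨pa, ha, pb, hb, hab⟩ := eventually_prod_iff.1 (eventually_lt_of_lt_liminf hc)
  obtain ⟨τ, ⟨⟨w', α'⟩, hepi, hw', hα'⟩, hτ⟩ :=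
    ((hmem _ (prod_mem_nhds hb (Iio_mem_nhds hαc))).and_eventually ha).exists
  have h1 : quot2For h x v τ w' ≤ α' := hepi
  have h2 : (c : EReal) < quot2For h x v τ w' := hab hτ hw'
  have h3 : (c : EReal) < α' := h2.trans_le h1
  exact absurd (EReal.coe_lt_coe_iff.1 h3) (not_lt.2 (le_of_lt hα'))

/-- Parabolic regularity and proper twice epi-differentiability of a function whose second
subderivative is bounded below in each critical direction by a value that recovery arcs attain,
and is infinite in all other directions. -/
theorem parabolicallyRegular_and_twiceEpiDifferentiable {r₀ : ℝ} (hr : h x = r₀)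
    (h0 : (0 : E) ∈ criticalCone h x v)
    (hnc : ∀ w ∉ criticalCone h x v, subderiv2For h x v w = ⊤)
    (hcrit : ∀ w ∈ criticalCone h x v, ∃ L : ℝ, (L : EReal) ≤ subderiv2For h x v w ∧
      HasRecoveryArcs h x v w L) :
    ParabolicallyRegularAt h x v ∧ ProperlyTwiceEpiDifferentiableAt h x v := by
  have hio : innerLim (𝓝[>] (0 : ℝ)) (fun τ => epi (quot2For h x v τ)) ⊆
    outerLim (𝓝[>] (0 : ℝ)) (fun τ => epi (quot2For h x v τ)) :=
      fun p hp U hU => (hp U hU).frequently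
  have hin : epi (subderiv2For h x v) ⊆
    innerLim (𝓝[>] (0 : ℝ)) (fun τ => epi (quot2For h x v τ)) := by
      rintro ⟨w, α⟩ hα U hU
      have hα : subderiv2For h x v w ≤ α := hα
      have hw : w ∈ criticalCone h x v := by
        by_contra hne
        rw [hnc w hne] at hα
        exact absurd hα (not_le.2 (EReal.coe_lt_top α))
      obtain ⟨L, hL, hrec⟩ := hcrit w hw
      obtain ⟨V, hV, W, hW, hVW⟩ := mem_nhds_prod_iff.1 hU
      obtain ⟨b, hbW, hb⟩ : ∃ b, b ∈ W ∧ α < b := by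
        have h1 : ∀ᶠ b in 𝓝[>] α, b ∈ W := nhdsWithin_le_nhds hW
        obtain ⟨b, hb1, hb2⟩ := (h1.and self_mem_nhdsWithin).exists
        exact ⟨b, hb1, hb2⟩
      have hLb : L < b := lt_of_le_of_lt (EReal.coe_le_coe_iff.1 (hL.trans hα)) hb
      obtain ⟨z, ζ, ρ, r, hb', hζ, hρ, heq⟩ := hrec b hLb
      have h2 : Tendsto (fun τ : ℝ => w + (τ / 2) • ζ τ) (𝓝[>] 0) (𝓝 w) := by
        simpa using tendsto_const_nhds.add ((tendsto_id_nhdsGT_zero.div_const 2).smul hζ)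
      have h3 := (hρ.sub ((tendsto_const_nhds (x := v)).inner hζ)).eventually (Iio_mem_nhds hb')
      filter_upwards [heq, self_mem_nhdsWithin, h2.eventually hV, h3] with τ h4 hτ h5 h6
      refine ⟨(w + (τ / 2) • ζ τ, b), ?_, hVW ⟨h5, hbW⟩⟩
      change quot2For h x v τ (w + (τ / 2) • ζ τ) ≤ b
      rw [quot2For_recovery hr hτ h4, EReal.coe_le_coe_iff]
      exact le_of_lt h6
  refine ⟨fun w hw => ?_, ⟨?_, ?_⟩, fun w => ?_, ⟨0, ?_⟩⟩
  · obtain ⟨L, hL, hrec⟩ := hcrit w hw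
    exact le_antisymm ((hrec.iInf_parSubderiv_le hr hw).trans hL)
      (le_iInf fun z => subderiv2For_le_parSubderiv hr hw z)
  · exact outerLim_epi_quot2For_subset.antisymm (hin.trans hio)
  · exact (hio.trans outerLim_epi_quot2For_subset).antisymm hin
  · by_cases hw : w ∈ criticalCone h x v
    · obtain ⟨L, hL, -⟩ := hcrit w hw
      exact ne_bot_of_le_ne_bot (EReal.coe_ne_bot L) hL
    · simp [hnc w hw]
  · obtain ⟨L, -, hrec⟩ := hcrit 0 h0
    have h1 := (le_iInf fun z => subderiv2For_le_parSubderiv hr h0 z).trans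
      (hrec.iInf_parSubderiv_le hr h0)
    exact lt_of_le_of_lt h1 (EReal.coe_lt_top L)

end Recovery

section Composite

variable {X Y : Type*} [NormedAddCommGroup X] [InnerProductSpace ℝ X]
  [NormedAddCommGroup Y] [InnerProductSpace ℝ Y] {ι : Type}
  {ϑ : Y → EReal} {F : X → Y} {x v : X} {A : X →L[ℝ] Y} {D : X →L[ℝ] X →L[ℝ] Y}

/-! ### Correction of arcs by metric subregularity -/

lemma HasTaylorTwo.parabolic_value (hF : HasTaylorTwo F x A D) (w z : X) {τ : ℝ} (hτ : 0 < τ) :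
    F (x + τ • w + (τ ^ 2 / 2) • z) = F x + τ • A w + (τ ^ 2 / 2) • parQuot F x w (τ, z) := by
  have hne : τ ^ 2 / 2 ≠ 0 := by positivity
  rw [parQuot, hF.semideriv_eq, smul_inv_smul₀ hne]
  abel

omit [InnerProductSpace ℝ X] [InnerProductSpace ℝ Y] in
lemma MSQC.exists_correction (h : MSQC ϑ F x) : ∃ κ : ℝ, 0 < κ ∧ ∀ᶠ x' in 𝓝 x, ∀ y, ϑ y < ⊤ →
    ∀ ρ : ℝ, 0 < ρ → ∃ x'', ϑ (F x'') < ⊤ ∧ ‖x'' - x'‖ ≤ κ * ‖F x' - y‖ + ρ := by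
  obtain ⟨-, κ, hκ, ε, hε, h⟩ := h
  refine ⟨κ, hκ, ?_⟩
  filter_upwards [Metric.closedBall_mem_nhds x hε] with x' hx' y hy ρ hρ
  have h1 : Metric.infEDist x' {u | (0 : Y) ∈ (fun y => F u - y) '' dom ϑ} <
      ENNReal.ofReal (κ * ‖F x' - y‖ + ρ) := by
    refine lt_of_le_of_lt ((h x' hx').trans (mul_le_mul_right
      (Metric.infEDist_le_edist_of_mem (Set.mem_image_of_mem (fun y => F x' - y) hy)) _)) ?_
    rw [edist_dist, ← ENNReal.ofReal_mul hκ.le, dist_zero_left]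
    exact (ENNReal.ofReal_lt_ofReal_iff (by positivity)).2 (lt_add_of_pos_right _ hρ)
  obtain ⟨x'', ⟨y'', hy'', h0⟩, hd⟩ := Metric.infEDist_lt_iff.1 h1
  refine ⟨x'', ?_, ?_⟩
  · have : F x'' = y'' := sub_eq_zero.1 h0
    rw [this]; exact hy''
  · rw [edist_dist, ENNReal.ofReal_lt_ofReal_iff (by positivity), dist_comm, dist_eq_norm] at hd
    exact hd.le

/-- If the parabolic arc `F x + τ A w + (τ² / 2) p` lies in the domain of `ϑ`, then the arc
`x + τ w + (τ² / 2) z` can be corrected to an arc in the domain of `ϑ ∘ F`, at a cost of second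
order controlled by the distance of the parabolic quotient of `F` to `p`. -/
lemma exists_corrected_arc (hF : HasTaylorTwo F x A D) (h : MSQC ϑ F x) :
    ∃ κ : ℝ, 0 < κ ∧ ∀ (w z : X) (p : Y),
      (∀ᶠ τ in 𝓝[>] (0 : ℝ), ϑ (F x + τ • A w + (τ ^ 2 / 2) • p) < ⊤) → ∃ ζ : ℝ → X,
        ∀ᶠ τ in 𝓝[>] (0 : ℝ), ϑ (F (x + τ • w + (τ ^ 2 / 2) • ζ τ)) < ⊤ ∧
          ‖ζ τ - z‖ ≤ κ * ‖parQuot F x w (τ, z) - p‖ + τ := by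
  obtain ⟨κ, hκ, hcor⟩ := h.exists_correction
  refine ⟨κ, hκ, fun w z p hp => ?_⟩
  have harc : Tendsto (fun τ : ℝ => x + τ • w + (τ ^ 2 / 2) • z) (𝓝[>] 0) (𝓝 x) :=
    ((by fun_prop : Continuous fun τ : ℝ => x + τ • w + (τ ^ 2 / 2) • z).tendsto' 0 x
      (by simp)).mono_left nhdsWithin_le_nhds
  have hex : ∀ᶠ τ in 𝓝[>] (0 : ℝ), ∃ ζ : X, ϑ (F (x + τ • w + (τ ^ 2 / 2) • ζ)) < ⊤ ∧
      ‖ζ - z‖ ≤ κ * ‖parQuot F x w (τ, z) - p‖ + τ := by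
    filter_upwards [hp, harc.eventually hcor, self_mem_nhdsWithin] with τ h1 h2 hτ
    have hτ : 0 < τ := hτ
    have hpos : 0 < τ ^ 2 / 2 := by positivity
    obtain ⟨x'', h3, h4⟩ := h2 _ h1 (τ ^ 2 / 2 * τ) (by positivity)
    refine ⟨z + (τ ^ 2 / 2)⁻¹ • (x'' - (x + τ • w + (τ ^ 2 / 2) • z)), ?_, ?_⟩
    · rw [smul_add, smul_inv_smul₀ hpos.ne']
      convert h3 using 3
      abel
    · rw [add_sub_cancel_left, norm_smul, norm_inv, Real.norm_of_nonneg hpos.le,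
        inv_mul_le_iff₀ hpos]
      refine h4.trans_eq ?_
      rw [hF.parabolic_value w z hτ, add_sub_add_left_eq_sub, ← smul_sub, norm_smul,
        Real.norm_of_nonneg hpos.le]
      ring
  choose! ζ hζ using fun τ (h : ∃ ζ : X, ϑ (F (x + τ • w + (τ ^ 2 / 2) • ζ)) < ⊤ ∧
      ‖ζ - z‖ ≤ κ * ‖parQuot F x w (τ, z) - p‖ + τ) => h
  exact ⟨ζ, hex.mono hζ⟩

variable (M : ConicModel ϑ (F x) ι)

/-- Arcs with a tangent second-order term stay in the corresponding piece. -/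
lemma ConicModel.eventually_arc {y : Y} (M : ConicModel ϑ y ι) {u p : Y} {i : ι}
    (hu : u ∈ polyCone (M.N i)) (hp : p ∈ M.tangent u i) :
    ∀ᶠ τ in 𝓝[>] (0 : ℝ), ϑ (y + τ • u + (τ ^ 2 / 2) • p) =
      (M.g i (y + τ • u + (τ ^ 2 / 2) • p) : EReal) := by
  have harc : Tendsto (fun τ : ℝ => y + τ • u + (τ ^ 2 / 2) • p) (𝓝[>] 0) (𝓝 y) :=
    ((by fun_prop : Continuous fun τ : ℝ => y + τ • u + (τ ^ 2 / 2) • p).tendsto' 0 y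
      (by simp)).mono_left nhdsWithin_le_nhds
  filter_upwards [tendsto_half_nhdsGT_zero.eventually (eventually_add_smul_mem_polyCone hu hp),
    M.eventually_eq harc i, self_mem_nhdsWithin] with τ h1 h2 hτ
  refine h2 ?_
  rw [parabolic_arc_eq, add_sub_cancel_left]
  exact (smul_mem_polyCone_iff hτ).2 h1

/-- Along a tangent direction some second-order correction of the arc `x + τ w` is feasible for
the linearized problem. -/
lemma exists_tangent_direction [FiniteDimensional ℝ X] [Finite ι] (hF : HasTaylorTwo F x A D)
    (h : MSQC ϑ F x) {w : X} {i₀ : ι} (hw : A w ∈ polyCone (M.N i₀)) :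
    ∃ (z : X) (i : ι), A w ∈ polyCone (M.N i) ∧ A z + D w w ∈ M.tangent (A w) i := by
  obtain ⟨κ, hκ, hcor⟩ := exists_corrected_arc hF h
  obtain ⟨ζ, hζ⟩ := hcor w 0 0 (by
    filter_upwards [M.eventually_ray hw] with τ h1
    rw [smul_zero, add_zero, h1]
    exact EReal.coe_lt_top _)
  set R : ℝ := κ * (‖D w w‖ + 1) + 1
  have hbdd : ∀ᶠ τ in 𝓝[>] (0 : ℝ), ζ τ ∈ Metric.closedBall (0 : X) R := by
    have h1 : Tendsto (fun τ : ℝ => parQuot F x w (τ, 0)) (𝓝[>] 0) (𝓝 (A 0 + D w w)) :=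
      (hF.tendsto_parQuot w 0).comp (tendsto_id.prodMk tendsto_const_nhds)
    rw [map_zero, zero_add] at h1
    filter_upwards [hζ, h1.norm.eventually (Iio_mem_nhds (lt_add_one _)),
      nhdsWithin_le_nhds (Iio_mem_nhds (zero_lt_one' ℝ))] with τ h2 h3 h4
    have h3 : ‖parQuot F x w (τ, 0)‖ < ‖D w w‖ + 1 := h3
    have h4 : τ < 1 := h4
    have h5 := h2.2
    rw [sub_zero, sub_zero] at h5
    rw [mem_closedBall_zero_iff]
    nlinarith
  obtain ⟨z, -, hz⟩ := (isCompact_closedBall (0 : X) R).exists_mapClusterPt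
    (le_principal_iff.2 hbdd : map ζ (𝓝[>] 0) ≤ 𝓟 _)
  obtain ⟨U, hU, hUz⟩ := mapClusterPt_iff_ultrafilter.1 hz
  have hUτ : Tendsto (fun τ : ℝ => τ) U (𝓝[>] 0) := hU
  have hq : Tendsto (fun τ : ℝ => parQuot F x w (τ, ζ τ)) U (𝓝 (A z + D w w)) :=
    (hF.tendsto_parQuot w z).comp (hUτ.prodMk hUz)
  have hval : ∀ᶠ τ in (U : Filter ℝ), F (x + τ • w + (τ ^ 2 / 2) • ζ τ) =
      F x + τ • (A w + (τ / 2) • parQuot F x w (τ, ζ τ)) := by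
    filter_upwards [hUτ.eventually self_mem_nhdsWithin] with τ hτ
    rw [hF.parabolic_value _ _ hτ, parabolic_arc_eq]
  have hhalf := tendsto_half_nhdsGT_zero.comp hUτ
  have hlim : Tendsto (fun τ : ℝ => F x + τ • (A w + (τ / 2) • parQuot F x w (τ, ζ τ))) U
      (𝓝 (F x)) := by
    have h0 : Tendsto (fun τ : ℝ => τ) U (𝓝 0) := hUτ.mono_right nhdsWithin_le_nhds
    simpa using tendsto_const_nhds.add (h0.smul
      ((tendsto_const_nhds (x := A w)).add ((h0.div_const 2).smul hq)))
  have hfr : ∃ᶠ τ in (U : Filter ℝ), ∃ i,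
      A w + (τ / 2) • parQuot F x w (τ, ζ τ) ∈ polyCone (M.N i) := by
    refine Eventually.frequently ?_
    filter_upwards [hval, M.eventually_value hlim, hU hζ, hUτ.eventually self_mem_nhdsWithin]
      with τ h1 h2 h3 hτ
    rw [h1] at h3
    obtain ⟨i, hi, -⟩ := h2 h3.1.ne
    rw [add_sub_cancel_left, smul_mem_polyCone_iff hτ] at hi
    exact ⟨i, hi⟩
  obtain ⟨i, hi⟩ := exists_frequently_of_frequently_exists hfr
  exact ⟨z, i, mem_polyCone_of_frequently hhalf hq hi⟩

/-- Feasible second-order terms of the linearized problem are realized by arcs in the domain of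
`ϑ ∘ F`, on which the composition has the expected second-order expansion. -/
lemma exists_recovery_arc [Finite ι] (hF : HasTaylorTwo F x A D) (h : MSQC ϑ F x)
    (hLip : StrictlyContinuousOnDom ϑ) {w z : X} {i : ι} (hw : A w ∈ polyCone (M.N i))
    (hz : A z + D w w ∈ M.tangent (A w) i) :
    ∃ (ζ : ℝ → X) (r : ℝ → ℝ), Tendsto ζ (𝓝[>] 0) (𝓝 z) ∧
      Tendsto r (𝓝[>] 0) (𝓝 (M.a i (A z + D w w) + M.D i (A w) (A w))) ∧
      ∀ᶠ τ in 𝓝[>] (0 : ℝ), ϑ (F (x + τ • w + (τ ^ 2 / 2) • ζ τ)) =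
        (((ϑ (F x)).toReal + τ * M.a i (A w) + τ ^ 2 / 2 * r τ : ℝ) : EReal) := by
  set p := A z + D w w with hp
  obtain ⟨κ, hκ, hcor⟩ := exists_corrected_arc hF h
  have hval := M.eventually_arc hw hz
  obtain ⟨ζ, hζ⟩ := hcor w z p (by
    filter_upwards [hval] with τ h1
    rw [h1]; exact EReal.coe_lt_top _)
  have hζlim : Tendsto ζ (𝓝[>] 0) (𝓝 z) := by
    rw [tendsto_iff_norm_sub_tendsto_zero]
    refine squeeze_zero' (.of_forall fun _ => norm_nonneg _) (hζ.mono fun τ hτ => hτ.2) ?_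
    have h1 : Tendsto (fun τ : ℝ => parQuot F x w (τ, z)) (𝓝[>] 0) (𝓝 p) :=
      (hF.tendsto_parQuot w z).comp (tendsto_id.prodMk tendsto_const_nhds)
    simpa using (((h1.sub_const p).norm.const_mul κ).add tendsto_id_nhdsGT_zero)
  have hqlim : Tendsto (fun τ : ℝ => parQuot F x w (τ, ζ τ)) (𝓝[>] 0) (𝓝 p) :=
    (hF.tendsto_parQuot w z).comp (tendsto_id.prodMk hζlim)
  set y₁ : ℝ → Y := fun τ => F x + τ • A w + (τ ^ 2 / 2) • p with hy₁
  set y₂ : ℝ → Y := fun τ => F (x + τ • w + (τ ^ 2 / 2) • ζ τ) with hy₂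
  have hy₂eq : ∀ᶠ τ in 𝓝[>] (0 : ℝ),
      y₂ τ = F x + τ • A w + (τ ^ 2 / 2) • parQuot F x w (τ, ζ τ) := by
    filter_upwards [self_mem_nhdsWithin] with τ hτ using hF.parabolic_value _ _ hτ
  have hsq : Tendsto (fun τ : ℝ => τ ^ 2 / 2) (𝓝[>] 0) (𝓝 0) := by
    simpa using (tendsto_id_nhdsGT_zero.pow 2).div_const 2
  have hlin : Tendsto (fun τ : ℝ => F x + τ • A w) (𝓝[>] 0) (𝓝 (F x)) := by
    simpa using tendsto_const_nhds.add
      (tendsto_id_nhdsGT_zero.smul (tendsto_const_nhds (x := A w)))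
  have hlim₁ : Tendsto y₁ (𝓝[>] 0) (𝓝 (F x)) := by
    simpa using hlin.add (hsq.smul (tendsto_const_nhds (x := p)))
  have hlim₂ : Tendsto y₂ (𝓝[>] 0) (𝓝 (F x)) := by
    have : Tendsto (fun τ : ℝ => F x + τ • A w + (τ ^ 2 / 2) • parQuot F x w (τ, ζ τ))
        (𝓝[>] 0) (𝓝 (F x)) := by simpa using hlin.add (hsq.smul hqlim)
    exact this.congr' (hy₂eq.mono fun τ hτ => hτ.symm)
  have hdom₁ : ∀ᶠ τ in 𝓝[>] (0 : ℝ), y₁ τ ∈ dom ϑ := by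
    filter_upwards [hval] with τ h1
    change ϑ _ < ⊤
    rw [h1]; exact EReal.coe_lt_top _
  have hdom₂ : ∀ᶠ τ in 𝓝[>] (0 : ℝ), y₂ τ ∈ dom ϑ := hζ.mono fun τ hτ => hτ.1
  have hFx : F x ∈ dom ϑ := by
    change ϑ _ < ⊤
    rw [M.value_eq i]; exact EReal.coe_lt_top _
  obtain ⟨K, t, ht, hK⟩ := hLip hFx
  have hin₁ := (tendsto_nhdsWithin_iff.2 ⟨hlim₁, hdom₁⟩).eventually ht
  have hin₂ := (tendsto_nhdsWithin_iff.2 ⟨hlim₂, hdom₂⟩).eventually ht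
  refine ⟨ζ, fun τ => (τ ^ 2 / 2)⁻¹ * ((ϑ (y₂ τ)).toReal - (ϑ (F x)).toReal - τ * M.a i (A w)),
    hζlim, ?_, ?_⟩
  · -- the value at the end point of the uncorrected arc in the image space
    have hmain : Tendsto (fun τ : ℝ => (τ ^ 2 / 2)⁻¹ * ((ϑ (y₁ τ)).toReal - (ϑ (F x)).toReal -
        τ * M.a i (A w))) (𝓝[>] 0) (𝓝 (M.a i p + M.D i (A w) (A w))) := by
      refine (((M.taylor i).tendsto_parQuot (A w) p).comp
        (tendsto_id.prodMk tendsto_const_nhds : Tendsto (fun t : ℝ => (t, p)) (𝓝[>] 0) _)).congr' ?_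
      filter_upwards [hval] with τ h1
      simp only [Function.comp_apply, parQuot, id_eq]
      rw [(M.taylor i).semideriv_eq, hy₁, h1, M.value_eq i, EReal.toReal_coe, EReal.toReal_coe,
        smul_eq_mul, smul_eq_mul]
    -- the correction costs `o(τ²)` by Lipschitz continuity
    have herr : Tendsto (fun τ : ℝ => (τ ^ 2 / 2)⁻¹ * ((ϑ (y₂ τ)).toReal - (ϑ (y₁ τ)).toReal))
        (𝓝[>] 0) (𝓝 0) := by
      have hq0 : Tendsto (fun τ : ℝ => (K : ℝ) * ‖parQuot F x w (τ, ζ τ) - p‖) (𝓝[>] 0) (𝓝 0) := by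
        simpa using ((hqlim.sub_const p).norm.const_mul (K : ℝ))
      refine squeeze_zero_norm' ?_ hq0
      filter_upwards [hin₁, hin₂, hy₂eq, self_mem_nhdsWithin] with τ h1 h2 h3 hτ
      have hτ : 0 < τ := hτ
      have hpos : 0 < τ ^ 2 / 2 := by positivity
      have h4 := hK.dist_le_mul _ h2 _ h1
      rw [dist_eq_norm, dist_eq_norm, h3, hy₁, add_sub_add_left_eq_sub, ← smul_sub, norm_smul,
        Real.norm_of_nonneg hpos.le, ← h3] at h4
      rw [norm_mul, norm_inv, Real.norm_of_nonneg hpos.le, inv_mul_le_iff₀ hpos]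
      linarith
    have := hmain.add herr
    rw [add_zero] at this
    refine this.congr fun τ => ?_
    ring
  · filter_upwards [hdom₂, M.eventually_value hlim₂, self_mem_nhdsWithin] with τ h1 h2 hτ
    have hτ : 0 < τ := hτ
    have hne : τ ^ 2 / 2 ≠ 0 := by positivity
    obtain ⟨j, -, hj⟩ := h2 (ne_of_lt h1)
    rw [mul_inv_cancel_left₀ hne]
    change ϑ (y₂ τ) = _
    rw [hj, EReal.toReal_coe]
    congr 1
    ring

/-! ### Lower estimates -/

lemma subderiv_comp_ge (hF : HasTaylorTwo F x A D) (w : X) :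
    subderiv ϑ (F x) (A w) ≤ subderiv (fun u => ϑ (F u)) x w := by
  have h1 : Tendsto (fun p : ℝ × X => (p.1, p.1⁻¹ • (F (x + p.1 • p.2) - F x)))
      (𝓝[>] (0 : ℝ) ×ˢ 𝓝 w) (𝓝[>] (0 : ℝ) ×ˢ 𝓝 (A w)) :=
    tendsto_fst.prodMk (hF.hasSemideriv w)
  refine (liminf_le_liminf_comp h1 _).trans_eq (liminf_congr ?_)
  filter_upwards [(tendsto_fst : Tendsto _ (𝓝[>] (0 : ℝ) ×ˢ 𝓝 w) _).eventually
    self_mem_nhdsWithin] with p hp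
  have hp : 0 < p.1 := hp
  simp only [Function.comp_apply]
  rw [smul_inv_smul₀ hp.ne', add_sub_cancel]

/-- A multiplier `ξ` bounds the second subderivative of the composition from below. -/
lemma le_subderiv2For_comp [Finite ι] [Nonempty ι] (hF : HasTaylorTwo F x A D) {ξ : Y}
    (hξ : ∀ i, ∀ u ∈ polyCone (M.N i), inner ℝ ξ u ≤ M.a i u)
    (hv : ∀ z, inner ℝ ξ (A z) = inner ℝ v z) {w : X} {c : ℝ}
    (hc : ∀ i, A w ∈ polyCone (M.N i) → c < M.D i (A w) (A w) + inner ℝ ξ (D w w)) :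
    (c : EReal) ≤ subderiv2For (fun u => ϑ (F u)) x v w := by
  refine le_liminf_of_le (by isBoundedDefault) ?_
  set l := 𝓝[>] (0 : ℝ) ×ˢ 𝓝 w
  set u' : ℝ × X → Y := fun p => p.1⁻¹ • (F (x + p.1 • p.2) - F x) with hu'
  have hu : Tendsto u' l (𝓝 (A w)) := hF.hasSemideriv w
  have hfst : Tendsto (fun p : ℝ × X => p.1) l (𝓝[>] 0) := tendsto_fst
  have hpos : ∀ᶠ p : ℝ × X in l, 0 < p.1 := hfst.eventually self_mem_nhdsWithin
  have hP : Tendsto (fun p : ℝ × X => F x + p.1 • u' p) l (𝓝 (F x)) := by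
    simpa using tendsto_const_nhds.add ((hfst.mono_right nhdsWithin_le_nhds).smul hu)
  have hi : ∀ i, ∀ᶠ p in l, u' p ∈ polyCone (M.N i) →
      c ≤ (p.1 ^ 2 / 2)⁻¹ • (M.g i (F x + p.1 • u' p) - M.g i (F x) - p.1 • M.a i (u' p)) +
        inner ℝ ξ ((p.1 ^ 2 / 2)⁻¹ • (F (x + p.1 • p.2) - F x - p.1 • A p.2)) := by
    intro i
    by_cases hiw : A w ∈ polyCone (M.N i)
    · have h1 := (((M.taylor i).tendsto_quot (A w)).comp (hfst.prodMk hu)).add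
        ((tendsto_const_nhds (x := ξ)).inner (hF.tendsto_quot w))
      filter_upwards [h1.eventually (Ioi_mem_nhds (hc i hiw))] with p hp _ using le_of_lt hp
    · filter_upwards [hu.eventually ((isClosed_polyCone (M.N i)).isOpen_compl.mem_nhds hiw)]
        with p hp h' using absurd h' hp
  obtain ⟨i₀⟩ := ‹Nonempty ι›
  filter_upwards [eventually_all.2 hi, M.eventually_value hP, hpos] with p h1 h2 hp
  rw [coe_le_quot2For_iff (h := fun u => ϑ (F u)) (M.value_eq i₀) hp]
  have hval : F (x + p.1 • p.2) = F x + p.1 • u' p := by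
    rw [hu']; simp only; rw [smul_inv_smul₀ hp.ne', add_sub_cancel]
  clear hu'
  clear_value u'
  by_cases htop : ϑ (F x + p.1 • u' p) = ⊤
  · rw [hval, htop]; exact le_top
  · obtain ⟨i, hmem, heq⟩ := h2 htop
    rw [add_sub_cancel_left, smul_mem_polyCone_iff hp] at hmem
    have h3 := h1 i hmem
    have h4 := EReal.coe_injective ((M.value_eq i₀).symm.trans (M.value_eq i))
    have h5 := hξ i _ hmem
    have hsq : 0 < p.1 ^ 2 / 2 := by positivity
    rw [hval, inner_smul_right, smul_eq_mul, ← mul_add, inv_mul_eq_div, le_div_iff₀ hsq,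
      add_sub_cancel_left, inner_sub_right, inner_smul_right, inner_smul_right, hv,
      smul_eq_mul] at h3
    rw [hval, heq, EReal.coe_le_coe_iff, h4]
    nlinarith

/-! ### Multipliers and the duality argument -/

/-- Critical directions are mapped into the domain of the first-order model, where the model is
exact for every multiplier. -/
lemma critical_direction [Finite ι] [Nonempty ι] (hF : HasTaylorTwo F x A D) {ξ : Y}
    (hξ : ∀ i, ∀ u ∈ polyCone (M.N i), inner ℝ ξ u ≤ M.a i u)
    (hv : ∀ z, inner ℝ ξ (A z) = inner ℝ v z) {w : X}
    (hw : w ∈ criticalCone (fun u => ϑ (F u)) x v) :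
    ∃ i, A w ∈ polyCone (M.N i) ∧ M.a i (A w) = inner ℝ v w := by
  have hw : subderiv (fun u => ϑ (F u)) x w = ((inner ℝ v w : ℝ) : EReal) := hw
  have hle := subderiv_comp_ge (ϑ := ϑ) hF w
  rw [hw] at hle
  have hex : ∃ i, A w ∈ polyCone (M.N i) := by
    by_contra hne
    have h1 : ((inner ℝ v w + 1 : ℝ) : EReal) ≤ subderiv ϑ (F x) (A w) :=
      M.le_subderiv fun i hi => absurd ⟨i, hi⟩ hne
    have h2 := EReal.coe_le_coe_iff.1 (h1.trans hle)
    linarith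
  obtain ⟨i, hi⟩ := hex
  refine ⟨i, hi, le_antisymm ?_ ?_⟩
  · rw [M.subderiv_eq hi] at hle
    exact_mod_cast hle
  · rw [← hv]; exact hξ i _ hi

lemma inner_le_subderiv_comp [Finite ι] [Nonempty ι] (hF : HasTaylorTwo F x A D) {ξ : Y}
    (hξ : ∀ i, ∀ u ∈ polyCone (M.N i), inner ℝ ξ u ≤ M.a i u)
    (hv : ∀ z, inner ℝ ξ (A z) = inner ℝ v z) (w : X) :
    ((inner ℝ v w : ℝ) : EReal) ≤ subderiv (fun u => ϑ (F u)) x w := by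
  refine le_trans (EReal.ge_of_forall_gt_iff_ge.1 fun c hc => ?_) (subderiv_comp_ge hF w)
  refine M.le_subderiv fun i hi => ?_
  have hc : c < inner ℝ v w := by exact_mod_cast hc
  exact hc.trans_le ((hv w).symm.trans_le (hξ i _ hi))

lemma zero_mem_criticalCone [Finite ι] [Nonempty ι] (hF : HasTaylorTwo F x A D) {ξ : Y}
    (hξ : ∀ i, ∀ u ∈ polyCone (M.N i), inner ℝ ξ u ≤ M.a i u)
    (hv : ∀ z, inner ℝ ξ (A z) = inner ℝ v z) :
    (0 : X) ∈ criticalCone (fun u => ϑ (F u)) x v := by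
  refine le_antisymm ?_ (inner_le_subderiv_comp M hF hξ hv 0)
  obtain ⟨i₀⟩ := ‹Nonempty ι›
  have h1 : Tendsto (fun τ : ℝ => (τ, (0 : X))) (𝓝[>] 0) (𝓝[>] (0 : ℝ) ×ˢ 𝓝 0) :=
    tendsto_id.prodMk tendsto_const_nhds
  refine (liminf_le_liminf_comp h1 _).trans_eq ?_
  have h2 : ((fun p : ℝ × X => ((fun u => ϑ (F u)) (x + p.1 • p.2) - (fun u => ϑ (F u)) x) /
      (p.1 : EReal)) ∘ fun τ : ℝ => (τ, (0 : X))) = fun _ => 0 := by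
    funext τ
    simp only [Function.comp_apply, smul_zero, add_zero]
    rw [M.value_eq i₀, ← EReal.coe_sub, sub_self, EReal.coe_zero, EReal.zero_div]
  rw [h2, liminf_const]
  simp

namespace ConicModel

variable {y : Y} (M : ConicModel ϑ y ι)

/-- Under regularity the directional model is subadditive over finite families of directions. -/
lemma exists_sum_tangent [FiniteDimensional ℝ Y] [Finite ι] [Nonempty ι] (hreg : RegularAt ϑ y)
    (hcl : IsClosed (epiL2 ϑ)) {u : Y} {i₀ : ι} (hu : u ∈ polyCone (M.N i₀)) {κ : Type*}
    (s : Finset κ) (idx : κ → ι) (p : κ → Y) (hidx : ∀ k ∈ s, u ∈ polyCone (M.N (idx k)))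
    (hp : ∀ k ∈ s, p k ∈ M.tangent u (idx k)) :
    ∃ i, u ∈ polyCone (M.N i) ∧ ∑ k ∈ s, p k ∈ M.tangent u i ∧
      M.a i (∑ k ∈ s, p k) ≤ ∑ k ∈ s, M.a (idx k) (p k) := by
  classical
  induction s using Finset.induction_on with
  | empty => exact ⟨i₀, hu, zero_mem_polyCone _, by simp⟩
  | insert k s hk ih =>
    obtain ⟨j, hj, hsum, hle⟩ := ih (fun k hk => hidx k (Finset.mem_insert_of_mem hk))
      (fun k hk => hp k (Finset.mem_insert_of_mem hk))
    obtain ⟨i, hi, hadd, hle'⟩ := M.exists_add_tangent hreg hcl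
      (hidx k (Finset.mem_insert_self _ _)) hj (hp k (Finset.mem_insert_self _ _)) hsum
    rw [Finset.sum_insert hk, Finset.sum_insert hk]
    exact ⟨i, hi, hadd, by linarith⟩

end ConicModel

/-- Strong duality for the second-order linear program of a critical direction `w`: some multiplier
`ξ`, active at `A w`, has a dual value `⟪ξ, D w w⟫` that primal feasible points approximate. -/
lemma exists_optimal_multiplier [FiniteDimensional ℝ X] [FiniteDimensional ℝ Y] [Fintype ι]
    [Nonempty ι] (hF : HasTaylorTwo F x A D) (h : MSQC ϑ F x) (hreg : RegularAt ϑ (F x))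
    (hcl : IsClosed (epiL2 ϑ)) {ξ₀ : Y} (hξ₀ : ξ₀ ∈ subdiff ϑ (F x))
    (hv : ∀ z, inner ℝ ξ₀ (A z) = inner ℝ v z) {w : X} {i₀ : ι}
    (hw : A w ∈ polyCone (M.N i₀)) (hwv : M.a i₀ (A w) = inner ℝ v w) :
    ∃ ξ ∈ activeSubgrads ϑ (F x) (A w), (∀ z, inner ℝ ξ (A z) = inner ℝ v z) ∧
      ∀ b : ℝ, inner ℝ ξ (D w w) < b → ∃ (z : X) (i : ι), A w ∈ polyCone (M.N i) ∧
        A z + D w w ∈ M.tangent (A w) i ∧ M.a i (A z + D w w) - inner ℝ v z < b := by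
  classical
  have hact₀ : ξ₀ ∈ activeSubgrads ϑ (F x) (A w) :=
    ⟨hξ₀, by rw [M.subderiv_eq hw, hwv, hv]⟩
  set S : Set ℝ := {r | ∃ (z : X) (i : ι), A w ∈ polyCone (M.N i) ∧
    A z + D w w ∈ M.tangent (A w) i ∧ M.a i (A z + D w w) - inner ℝ v z = r} with hS
  have hne : S.Nonempty := by
    obtain ⟨z, i, h1, h2⟩ := exists_tangent_direction M hF h hw
    exact ⟨_, z, i, h1, h2, rfl⟩
  have hbdd : BddBelow S := by
    refine ⟨inner ℝ ξ₀ (D w w), ?_⟩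
    rintro r ⟨z, i, h1, h2, rfl⟩
    have h3 := M.inner_le_of_mem_activeSubgrads hreg h1 h2 hact₀
    rw [inner_add_right, hv] at h3
    linarith
  obtain ⟨ξ, hξ, hξv, hξc⟩ := exists_dual_feasible
    (fun i : {i : ι // A w ∈ polyCone (M.N i)} => activeNormals (M.N i) (A w))
    (fun i => M.a i) A v (D w w) (sInf S) (by
      intro p hp z μ hμ hsum
      obtain ⟨i, hi, hmem, hle⟩ := M.exists_sum_tangent hreg hcl hw Finset.univ
        (fun i : {i : ι // A w ∈ polyCone (M.N i)} => i.1) p (fun k _ => k.2) (fun k _ => hp k)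
      rw [hsum] at hmem hle
      refine le_trans ?_ hle
      rcases hμ.eq_or_lt with rfl | hμ
      · have h3 := M.inner_le_of_mem_activeSubgrads hreg hi hmem hact₀
        rw [zero_smul, add_zero, hv] at h3
        simpa using h3
      · have h4 : A z + μ • D w w = μ • (A (μ⁻¹ • z) + D w w) := by
          rw [smul_add, map_smul, smul_inv_smul₀ hμ.ne']
        rw [h4] at hmem ⊢
        have h5 : M.a i (A (μ⁻¹ • z) + D w w) - inner ℝ v (μ⁻¹ • z) ∈ S :=
          ⟨μ⁻¹ • z, i, hi, (smul_mem_polyCone_iff hμ).1 hmem, rfl⟩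
        have h6 := mul_le_mul_of_nonneg_left (csInf_le hbdd h5) hμ.le
        rw [mul_sub, inner_smul_right, mul_inv_cancel_left₀ hμ.ne'] at h6
        rw [map_smul, smul_eq_mul]
        linarith)
  refine ⟨ξ, M.mem_activeSubgrads_of_le hreg hcl hw fun i hi p hp => hξ ⟨i, hi⟩ p hp, hξv,
    fun b hb => ?_⟩
  obtain ⟨r, ⟨z, i, h1, h2, rfl⟩, hr⟩ := exists_lt_of_csInf_lt hne (hξc.trans_lt hb)
  exact ⟨z, i, h1, h2, hr⟩

end Composite

end CompositeVA

theorem proposition5p5 {X : Type*} [NormedAddCommGroup X] [InnerProductSpace ℝ X]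
    [FiniteDimensional ℝ X] (m : ℕ)
    (ϑ : EuclideanSpace ℝ (Fin m) → EReal) (F : X → EuclideanSpace ℝ (Fin m))
    (hϑ : CompositeVA.IsPWTD ϑ) (hϑc : CompositeVA.StrictlyContinuousOnDom ϑ)
    (O : Set X) (hO : IsOpen O) (hFO : F ⁻¹' CompositeVA.dom ϑ ⊆ O)
    (hF : CompositeVA.TwiceDifferentiableOn F O)
    (f : X → EReal) (hf : ∀ x, f x = ϑ (F x))
    (x : X) (hx : x ∈ CompositeVA.dom f)
    (v : X) (hv : v ∈ CompositeVA.subdiff f x)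
    (hMSQC : CompositeVA.MSQC ϑ F x)
    (hchain : CompositeVA.subdiff f x ⊆
      LinearMap.adjoint (fderiv ℝ F x).toLinearMap '' CompositeVA.subdiff ϑ (F x))
    (hreg : CompositeVA.RegularAt ϑ (F x)) :
    CompositeVA.SuffCondition ϑ F x v ∧
      CompositeVA.ParabolicallyRegularAt f x v ∧
      CompositeVA.ProperlyTwiceEpiDifferentiableAt f x v := by
  open CompositeVA in
  obtain rfl : f = fun u => ϑ (F u) := funext hf
  have hxϑ : ϑ (F x) < ⊤ := hx
  have hT := hF.hasTaylorTwo hO (hFO hx)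
  set A := fderiv ℝ F x
  set D := fderiv ℝ (fderiv ℝ F) x
  have hcl := hϑ.isClosed_epiL2
  obtain ⟨ι, _, _, ⟨M⟩⟩ := hϑ.exists_conicModel hxϑ
  obtain ⟨i₁⟩ := ‹Nonempty ι›
  have : Nonempty ι := ⟨i₁⟩
  obtain ⟨ξ₀, hξ₀, hξ₀v⟩ := hchain hv
  have hv₀ : ∀ z, inner ℝ ξ₀ (A z) = inner ℝ v z := fun z => by
    rw [← hξ₀v, LinearMap.adjoint_inner_left]; rfl
  have hdom₀ : ∀ i, ∀ u ∈ polyCone (M.N i), inner ℝ ξ₀ u ≤ M.a i u :=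
    fun i u hu => M.le_of_mem_subdiff hreg hξ₀ hu
  refine ⟨⟨hT.parabolicallySemidifferentiableAt, fun w hw => ?_⟩, ?_⟩
  · obtain ⟨i₀, hi₀, hwv⟩ := critical_direction M hT hdom₀ hv₀ hw
    obtain ⟨ξ, hact, hξv, hprimal⟩ :=
      exists_optimal_multiplier M hT hMSQC hreg hcl hξ₀ hv₀ hi₀ hwv
    refine ⟨ξ, ⟨hact.1, fun w' => by rw [hT.semideriv_eq, hξv]⟩, ?_⟩
    rw [hT.subderiv2_scalarization, hT.semideriv_eq]
    simp only [hT.parSemideriv_eq]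
    refine le_antisymm (EReal.le_of_forall_lt_iff_le.1 fun b hb => ?_) (le_iInf fun z => ?_)
    · obtain ⟨z, i, hi, hz, hlt⟩ := hprimal b (by exact_mod_cast hb)
      have hsup : (⨆ u ∈ activeSubgrads ϑ (F x) (A w), ((inner ℝ u (A z + D w w) : ℝ) : EReal)) ≤
          (M.a i (A z + D w w) : EReal) := iSup₂_le fun u hu => by
        exact_mod_cast M.inner_le_of_mem_activeSubgrads hreg hi hz hu
      refine (iInf_le _ z).trans ((EReal.sub_le_sub hsup le_rfl).trans ?_)
      rw [← EReal.coe_sub, EReal.coe_le_coe_iff]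
      exact hlt.le
    · have hle := le_iSup₂ (f := fun u (_ : u ∈ activeSubgrads ϑ (F x) (A w)) =>
        ((inner ℝ u (A z + D w w) : ℝ) : EReal)) ξ hact
      refine le_trans ?_ (EReal.sub_le_sub hle le_rfl)
      rw [← EReal.coe_sub, EReal.coe_le_coe_iff, inner_add_right, hξv]
      linarith
  · refine parabolicallyRegular_and_twiceEpiDifferentiable (M.value_eq i₁)
      (zero_mem_criticalCone M hT hdom₀ hv₀) (fun w hw => ?_) (fun w hw => ?_)
    · exact subderiv2For_eq_top (M.value_eq i₁)
        (lt_of_le_of_ne (inner_le_subderiv_comp M hT hdom₀ hv₀ w) (Ne.symm hw))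
    · obtain ⟨i₀, hi₀, hwv⟩ := critical_direction M hT hdom₀ hv₀ hw
      obtain ⟨ξ, hact, hξv, hprimal⟩ :=
        exists_optimal_multiplier M hT hMSQC hreg hcl hξ₀ hv₀ hi₀ hwv
      refine ⟨M.D i₀ (A w) (A w) + inner ℝ ξ (D w w), ?_, fun b hb => ?_⟩
      · refine EReal.ge_of_forall_gt_iff_ge.1 fun c hc => ?_
        refine le_subderiv2For_comp M hT (fun i u hu => M.le_of_mem_subdiff hreg hact.1 hu) hξv
          fun i hi => ?_
        rw [M.D_eq hi hi₀]
        exact_mod_cast hc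
      · obtain ⟨z, i, hi, hz, hlt⟩ := hprimal (b - M.D i₀ (A w) (A w)) (by linarith)
        obtain ⟨ζ, r, hζ, hr, heq⟩ := exists_recovery_arc M hT hMSQC hϑc hi hz
        refine ⟨z, ζ, _, r, ?_, hζ, hr, ?_⟩
        · rw [M.D_eq hi hi₀]; linarith
        · rw [M.a_eq hi hi₀, hwv] at heq
          exact heq
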